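/- Let $M$ be a hypercomplex manifold, i.e. a smooth manifold with a smooth action of the quaternion algebra $\mathbb H$ on its tangent bundle such that every almost complex structure given by $L\in\mathbb H$, $L^2=-1$, is integrable, and let $h$ be a Riemannian metric on $M$ that is invariant under the group $SU(2)$ of unit quaternions (so $M$ is hypercomplex Hermitian). For $L\in\mathbb H$, $L^2=-1$, put $\omega_L(x,y)=h(x,Ly)$. Let $I$ be any induced complex structure, completed to a standard quaternion triple $I,J,K$ (that is, $I^2=J^2=K^2=-1$, $IJ=K$), let $\Omega=\frac12(\omega_J+\sqrt{-1}\,\omega_K)\in\Lambda^{2,0}(M,I)$, and let $\partial:\Lambda^{2,0}(M,I)\to\Lambda^{3,0}(M,I)$ be the Dolbeault differential of the complex manifold $(M,I)$. Let $SU(2)$ act on complex-valued differential forms, and call an irreducible $SU(2)$-representation of complex dimension $k+1$ a representation of weight $k$. Let $\Lambda^n_+(M)\subset\Lambda^n(M)$ be the sum of all irreducible subrepresentations of weight $n$, let $V^n$ be the sum of those of weight less than $n$, so that $\Lambda^n(M)=\Lambda^n_+(M)\oplus V^n$, and let the quaternionic Dolbeault (Salamon) differential $d_+:\Lambda^n_+(M)\to\Lambda^{n+1}_+(M)$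 be the de Rham differential followed by the projection to $\Lambda^{n+1}_+(M)$ along $V^{n+1}$. Then $\partial\Omega=0$ if and only if $d_+\omega_I=0$. Consequently $M$ is HKT, i.e. satisfies $\partial\Omega=0$ for the form $\Omega$ of the standard basis $i,j,k$ of $\mathbb H$, if and only if $d_+\omega_I=0$ for the (arbitrary) induced complex structure $I$. -/

import Mathlib

open Bundle Manifold
open scoped Quaternion ContDiff

noncomputable section

namespace Hypercomplex

/-! ### Imaginary units of the quaternions -/

/-- The quaternions `L` with `L² = -1`. -/
structure ImaginaryUnit where
  val : ℍ[ℝ]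
  sq_eq : val * val = -1

instance : Coe ImaginaryUnit ℍ[ℝ] := ⟨ImaginaryUnit.val⟩

/-- A standard basis `I, J, K` of the imaginary quaternions: `I² = J² = K² = -1`, `IJ = K`
(and therefore `JI = -K`). -/
structure QuaternionTriple where
  I : ImaginaryUnit
  J : ImaginaryUnit
  K : ImaginaryUnit
  mul_eq : (I : ℍ[ℝ]) * (J : ℍ[ℝ]) = (K : ℍ[ℝ])

/-- The quaternion `a + b i + c j + d k`. -/
def quat (a b c d : ℝ) : ℍ[ℝ] := ⟨a, b, c, d⟩

@[simp] theorem quat_re (a b c d : ℝ) : (quat a b c d).re = a := rfl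
@[simp] theorem quat_imI (a b c d : ℝ) : (quat a b c d).imI = b := rfl
@[simp] theorem quat_imJ (a b c d : ℝ) : (quat a b c d).imJ = c := rfl
@[simp] theorem quat_imK (a b c d : ℝ) : (quat a b c d).imK = d := rfl

/-- The triple `i, j, k` of the quaternion algebra. -/
def stdTriple : QuaternionTriple where
  I := ⟨quat 0 1 0 0, by ext <;> simp⟩
  J := ⟨quat 0 0 1 0, by ext <;> simp⟩
  K := ⟨quat 0 0 0 1, by ext <;> simp⟩
  mul_eq := by ext <;> simp

/-! ### Linear algebra of complex valued exterior forms -/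

section LinearAlgebra

variable {V : Type*} [AddCommGroup V] [Module ℝ V] [TopologicalSpace V]

/-- The term of the Hodge projection belonging to a set `S` of holomorphic slots and a set `T`
of slots in which the complex structure `L` is inserted. -/
def hodgeTerm (L : V →L[ℝ] V) {n : ℕ} (η : V [⋀^Fin n]→L[ℝ] ℂ) (S T : Finset (Fin n)) :
    ContinuousMultilinearMap ℝ (fun _ : Fin n => V) ℂ :=
  ((1 / 2 : ℂ) ^ n *
      ∏ j : Fin n, if j ∈ T then (if j ∈ S then -Complex.I else Complex.I) else 1) •
    η.toContinuousMultilinearMap.compContinuousLinearMap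
      (fun j => if j ∈ T then L else ContinuousLinearMap.id ℝ V)

theorem hodgeTerm_apply (L : V →L[ℝ] V) {n : ℕ} (η : V [⋀^Fin n]→L[ℝ] ℂ) (S T : Finset (Fin n))
    (v : Fin n → V) :
    hodgeTerm L η S T v = ((1 / 2 : ℂ) ^ n *
      ∏ j : Fin n, if j ∈ T then (if j ∈ S then -Complex.I else Complex.I) else 1) *
        η (fun j => if j ∈ T then L (v j) else v j) := by
  have h : (fun j => (if j ∈ T then L else ContinuousLinearMap.id ℝ V) (v j)) =
      fun j => if j ∈ T then L (v j) else v j := by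
    funext j
    split_ifs <;> rfl
  rw [← h]
  rfl

theorem hodgeTerm_perm (L : V →L[ℝ] V) {n : ℕ} (η : V [⋀^Fin n]→L[ℝ] ℂ) (σ : Equiv.Perm (Fin n))
    (S T : Finset (Fin n)) (v : Fin n → V) (hv : v ∘ σ = v) :
    hodgeTerm L η (S.map σ.toEmbedding) (T.map σ.toEmbedding) v =
      ((Equiv.Perm.sign σ : ℤ) : ℂ) * hodgeTerm L η S T v := by
  have hm : ∀ (A : Finset (Fin n)) (j : Fin n), σ j ∈ A.map σ.toEmbedding ↔ j ∈ A := by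
    intro A j; simp
  have h1 : (∏ j : Fin n, if j ∈ T.map σ.toEmbedding then
        (if j ∈ S.map σ.toEmbedding then -Complex.I else Complex.I) else 1) =
      ∏ j : Fin n, if j ∈ T then (if j ∈ S then -Complex.I else Complex.I) else 1 := by
    rw [← Equiv.prod_comp σ]
    simp only [hm]
  have h2 : (fun j => if j ∈ T then L (v j) else v j) =
      (fun j => if j ∈ T.map σ.toEmbedding then L (v j) else v j) ∘ σ := by
    funext j
    have : v (σ j) = v j := congrFun hv j
    simp only [Function.comp, hm, this]
  have h3 : η (fun j => if j ∈ T then L (v j) else v j) = ((Equiv.Perm.sign σ : ℤ) : ℂ) *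
      η (fun j => if j ∈ T.map σ.toEmbedding then L (v j) else v j) := by
    rw [h2]
    have := η.toAlternatingMap.map_perm
      (fun j => if j ∈ T.map σ.toEmbedding then L (v j) else v j) σ
    simp only [ContinuousAlternatingMap.coe_toAlternatingMap] at this
    rw [this, Units.smul_def, zsmul_eq_mul]
  have h4 : ((Equiv.Perm.sign σ : ℤ) : ℂ) * ((Equiv.Perm.sign σ : ℤ) : ℂ) = 1 := by
    rcases Int.units_eq_one_or (Equiv.Perm.sign σ) with h | h <;> simp [h]
  rw [hodgeTerm_apply, hodgeTerm_apply, h1, h3, mul_left_comm, ← mul_assoc _ _ (η _), h4, one_mul]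

/-- The component of type `(p, n - p)` of an `n`-form `η` with respect to a complex structure `L`
(a form `α` of type `(1, 0)` satisfies `α (L v) = √-1 α v`): extend `η` complex multilinearly and
insert the holomorphic part `(v - √-1 L v) / 2` of the argument in `p` slots and the
antiholomorphic part `(v + √-1 L v) / 2` in the other slots, in all possible ways. -/
def hodgePart (L : V →L[ℝ] V) (p : ℕ) {n : ℕ} (η : V [⋀^Fin n]→L[ℝ] ℂ) : V [⋀^Fin n]→L[ℝ] ℂ where
  toContinuousMultilinearMap :=
    ∑ S ∈ Finset.powersetCard p (Finset.univ : Finset (Fin n)), ∑ T : Finset (Fin n),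
      hodgeTerm L η S T
  map_eq_zero_of_eq' := by
    intro v i j hij hne
    show (∑ S ∈ Finset.powersetCard p (Finset.univ : Finset (Fin n)), ∑ T : Finset (Fin n),
      hodgeTerm L η S T) v = 0
    simp only [_root_.sum_apply]
    set σ : Equiv.Perm (Fin n) := Equiv.swap i j with hσ
    have hv : v ∘ σ = v := by
      funext l
      simp only [Function.comp, hσ, Equiv.swap_apply_def]
      split_ifs with h h'
      · rw [h, hij]
      · rw [h', hij]
      · rfl
    have hneg : ∀ S T : Finset (Fin n),
        hodgeTerm L η (S.map σ.toEmbedding) (T.map σ.toEmbedding) v = -hodgeTerm L η S T v := by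
      intro S T
      rw [hodgeTerm_perm L η σ S T v hv, hσ, Equiv.Perm.sign_swap hne]
      simp
    have hT : ∀ f : Finset (Fin n) → ℂ,
        ∑ T : Finset (Fin n), f (T.map σ.toEmbedding) = ∑ T : Finset (Fin n), f T :=
      fun f => Equiv.sum_comp (Equiv.finsetCongr σ) f
    have hS : ∀ f : Finset (Fin n) → ℂ,
        ∑ S ∈ Finset.powersetCard p (Finset.univ : Finset (Fin n)), f (S.map σ.toEmbedding) =
          ∑ S ∈ Finset.powersetCard p (Finset.univ : Finset (Fin n)), f S := by
      intro f
      refine Finset.sum_equiv (Equiv.finsetCongr σ) ?_ ?_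
      · intro S; simp [Finset.mem_powersetCard]
      · intro S _; simp
    have key : ∑ S ∈ Finset.powersetCard p (Finset.univ : Finset (Fin n)),
        ∑ T : Finset (Fin n), hodgeTerm L η S T v =
        -∑ S ∈ Finset.powersetCard p (Finset.univ : Finset (Fin n)),
        ∑ T : Finset (Fin n), hodgeTerm L η S T v := by
      conv_lhs => rw [← hS]
      rw [← Finset.sum_neg_distrib]
      refine Finset.sum_congr rfl fun S _ => ?_
      rw [← hT, ← Finset.sum_neg_distrib]
      exact Finset.sum_congr rfl fun T _ => hneg S T
    exact self_eq_neg.mp key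

variable [IsTopologicalAddGroup V] [ContinuousConstSMul ℝ V]

/-- The action of the group `SU(2)` of unit quaternions on `n`-forms that is induced by an action
of the quaternions on `V`: `(g • η) (v₁, …, vₙ) = η (g⁻¹ v₁, …, g⁻¹ vₙ)`. -/
def formRep (A : ℍ[ℝ] →ₐ[ℝ] (V →L[ℝ] V)) (n : ℕ) :
    Representation ℂ (unitary ℍ[ℝ]) (V [⋀^Fin n]→L[ℝ] ℂ) where
  toFun g :=
    { toFun := fun η => η.compContinuousLinearMap (A ((g⁻¹ : unitary ℍ[ℝ]) : ℍ[ℝ]))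
      map_add' := fun _ _ => rfl
      map_smul' := fun _ _ => rfl }
  map_one' := by
    ext η v
    show η (fun j => A _ (v j)) = η v
    simp
  map_mul' g g' := by
    ext η v
    show η (fun j => A _ (v j)) = η (fun j => A _ (A _ (v j)))
    congr 1
    funext j
    rw [mul_inv_rev, Submonoid.coe_mul, map_mul]
    rfl

/-- The sum of all irreducible subrepresentations of weight `k`, that is, of complex
dimension `k + 1`. -/
def weightSubspace {W : Type*} [AddCommGroup W] [Module ℂ W]
    (ρ : Representation ℂ (unitary ℍ[ℝ]) W) (k : ℕ) : Submodule ℂ W :=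
  ⨆ (U : Subrepresentation ρ)
    (_ : U.toRepresentation.IsIrreducible ∧ Module.finrank ℂ U.toSubmodule = k + 1), U.toSubmodule

/-- `Λⁿ₊`: the maximal subspace of the `n`-forms on which `SU(2)` acts with weight `n`. -/
def plusSubspace (A : ℍ[ℝ] →ₐ[ℝ] (V →L[ℝ] V)) (n : ℕ) : Submodule ℂ (V [⋀^Fin n]→L[ℝ] ℂ) :=
  weightSubspace (formRep A n) n

/-- The sum of all `SU(2)`-subspaces of the `n`-forms of weight less than `n`. -/
def lowSubspace (A : ℍ[ℝ] →ₐ[ℝ] (V →L[ℝ] V)) (n : ℕ) : Submodule ℂ (V [⋀^Fin n]→L[ℝ] ℂ) :=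
  ⨆ k ∈ Set.Iio n, weightSubspace (formRep A n) k

open Classical in
/-- The projection of the `n`-forms onto `Λⁿ₊` along the sum of all subspaces of lower weight.
(For finite dimensional `V` the two subspaces are always complementary, by complete reducibility
and because only weights at most `n` occur in the `n`-forms.) -/
def plusProj (A : ℍ[ℝ] →ₐ[ℝ] (V →L[ℝ] V)) (n : ℕ) :
    (V [⋀^Fin n]→L[ℝ] ℂ) →ₗ[ℂ] (V [⋀^Fin n]→L[ℝ] ℂ) :=
  if h : IsCompl (plusSubspace A n) (lowSubspace A n) then (plusSubspace A n).projection (lowSubspace A n) h else 0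

end LinearAlgebra

/-! ### Differential forms on manifolds -/

section Manifold

variable {E : Type*} [NormedAddCommGroup E] [NormedSpace ℝ E]
  {M : Type*} [TopologicalSpace M] [ChartedSpace E M]

variable (E M) in
/-- Complex valued differential `n`-forms on `M` (with no regularity imposed). -/
abbrev DiffForm (n : ℕ) : Type _ :=
  (x : M) → TangentSpace 𝓘(ℝ, E) x [⋀^Fin n]→L[ℝ] ℂ

/-- The differential form `η` written in the preferred chart around `x`. -/
def DiffForm.inChart {n : ℕ} (η : DiffForm E M n) (x : M) (y : E) : E [⋀^Fin n]→L[ℝ] ℂ :=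
  (η ((extChartAt 𝓘(ℝ, E) x).symm y)).compContinuousLinearMap
    (mfderiv 𝓘(ℝ, E) 𝓘(ℝ, E) (extChartAt 𝓘(ℝ, E) x).symm y)

/-- The de Rham differential: at `x` it is computed in the preferred chart around `x`. -/
def deRham {n : ℕ} (η : DiffForm E M n) : DiffForm E M (n + 1) := fun x =>
  (extDeriv (η.inChart x) (extChartAt 𝓘(ℝ, E) x x)).compContinuousLinearMap
    (mfderiv 𝓘(ℝ, E) 𝓘(ℝ, E) (extChartAt 𝓘(ℝ, E) x) x)

/-- The Nijenhuis tensor of an endomorphism field `L` of the tangent bundle, evaluated on two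
vector fields: `[LX, LY] - L[LX, Y] - L[X, LY] - [X, Y]`. -/
def nijenhuis (L : (x : M) → TangentSpace 𝓘(ℝ, E) x →L[ℝ] TangentSpace 𝓘(ℝ, E) x)
    (X Y : (x : M) → TangentSpace 𝓘(ℝ, E) x) (x : M) : TangentSpace 𝓘(ℝ, E) x :=
  VectorField.mlieBracket 𝓘(ℝ, E) (fun y => L y (X y)) (fun y => L y (Y y)) x
    - L x (VectorField.mlieBracket 𝓘(ℝ, E) (fun y => L y (X y)) Y x)
    - L x (VectorField.mlieBracket 𝓘(ℝ, E) X (fun y => L y (Y y)) x)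
    - VectorField.mlieBracket 𝓘(ℝ, E) X Y x

variable [IsManifold 𝓘(ℝ, E) ∞ M]

/-- An almost complex structure is integrable if its Nijenhuis tensor vanishes. -/
def IsIntegrable (L : (x : M) → TangentSpace 𝓘(ℝ, E) x →L[ℝ] TangentSpace 𝓘(ℝ, E) x) : Prop :=
  ∀ (x : M) (X Y : (y : M) → TangentSpace 𝓘(ℝ, E) y),
    ContMDiffAt 𝓘(ℝ, E) 𝓘(ℝ, E).tangent ∞ (fun y => (⟨y, X y⟩ : TangentBundle 𝓘(ℝ, E) M)) x →
    ContMDiffAt 𝓘(ℝ, E) 𝓘(ℝ, E).tangent ∞ (fun y => (⟨y, Y y⟩ : TangentBundle 𝓘(ℝ, E) M)) x →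
    nijenhuis L X Y x = 0

variable (E M) in
/-- A hypercomplex structure: a smooth action of the quaternion algebra on the tangent bundle such
that every induced almost complex structure is integrable. -/
structure HypercomplexStructure where
  act (x : M) : ℍ[ℝ] →ₐ[ℝ] (TangentSpace 𝓘(ℝ, E) x →L[ℝ] TangentSpace 𝓘(ℝ, E) x)
  contMDiff_act (q : ℍ[ℝ]) : ContMDiff 𝓘(ℝ, E) (𝓘(ℝ, E).prod 𝓘(ℝ, E →L[ℝ] E)) ∞
    (fun x => TotalSpace.mk' (E →L[ℝ] E)
      (E := fun x : M => TangentSpace 𝓘(ℝ, E) x →L[ℝ] TangentSpace 𝓘(ℝ, E) x) x (act x q))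
  integrable (L : ImaginaryUnit) : IsIntegrable (fun x => act x L)

/-- A quaternionic Hermitian metric on a hypercomplex manifold: a smooth Riemannian metric that is
invariant under the group of unit quaternions. -/
structure QuaternionicHermitianMetric (Q : HypercomplexStructure E M)
    extends ContMDiffRiemannianMetric 𝓘(ℝ, E) ∞ E
      (fun x : M => TangentSpace 𝓘(ℝ, E) x) where
  invariant (x : M) (g : unitary ℍ[ℝ]) (u v : TangentSpace 𝓘(ℝ, E) x) :
    inner x (Q.act x (g : ℍ[ℝ]) u) (Q.act x (g : ℍ[ℝ]) v) = inner x u v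

variable {Q : HypercomplexStructure E M}

theorem ImaginaryUnit.mem_unitary (L : ImaginaryUnit) : (L : ℍ[ℝ]) ∈ unitary ℍ[ℝ] := by
  have h : ‖(L : ℍ[ℝ])‖ * ‖(L : ℍ[ℝ])‖ = 1 := by
    rw [← norm_mul, L.sq_eq, norm_neg, norm_one]
  have h' : Quaternion.normSq (L : ℍ[ℝ]) = 1 := by rw [Quaternion.normSq_eq_norm_mul_self, h]
  rw [Unitary.mem_iff]
  constructor
  · rw [Quaternion.star_mul_self, h']; rfl
  · rw [Quaternion.self_mul_star, h']; rfl

theorem QuaternionicHermitianMetric.inner_act_self (h : QuaternionicHermitianMetric Q)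
    (L : ImaginaryUnit) (x : M) (v : TangentSpace 𝓘(ℝ, E) x) :
    h.inner x v (Q.act x L v) = 0 := by
  have h1 := h.invariant x ⟨L, L.mem_unitary⟩ v (Q.act x L v)
  have h2 : Q.act x (L : ℍ[ℝ]) (Q.act x (L : ℍ[ℝ]) v) = -v := by
    have := congrArg (fun f => f v) (map_mul (Q.act x) (L : ℍ[ℝ]) (L : ℍ[ℝ]))
    rw [L.sq_eq] at this
    simpa using this.symm
  simp only [h2, map_neg] at h1
  have h3 := h.symm x v (Q.act x L v)
  linarith

/-- The 2-form `ω_L (u, v) = h (u, L v)` of an induced complex structure `L`. -/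
def QuaternionicHermitianMetric.omega (h : QuaternionicHermitianMetric Q) (L : ImaginaryUnit) :
    DiffForm E M 2 := fun x =>
  { toFun := fun v => ((h.inner x (v 0) (Q.act x L (v 1)) : ℝ) : ℂ)
    map_update_add' := by
      intro _ v i u w
      fin_cases i <;> simp
    map_update_smul' := by
      intro _ v i c u
      fin_cases i <;> simp
    cont := by
      let B : E →L[ℝ] E →L[ℝ] ℝ := h.inner x
      let A : E →L[ℝ] E := Q.act x L
      have hB : Continuous fun v : Fin 2 → E => ((B (v 0) (A (v 1)) : ℝ) : ℂ) := by fun_prop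
      exact hB
    map_eq_zero_of_eq' := by
      intro v i j hij hne
      have h01 : v 0 = v 1 := by
        fin_cases i <;> fin_cases j <;> simp_all
      show ((h.inner x (v 0) (Q.act x L (v 1)) : ℝ) : ℂ) = 0
      rw [h01, h.inner_act_self L x (v 1), Complex.ofReal_zero] }

/-- The form `Ω = (ω_J + √-1 ω_K) / 2`, of type `(2, 0)` with respect to `I`. -/
def QuaternionicHermitianMetric.Omega (h : QuaternionicHermitianMetric Q) (t : QuaternionTriple) :
    DiffForm E M 2 := fun x => (1 / 2 : ℂ) • (h.omega t.J x + Complex.I • h.omega t.K x)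

/-- The Dolbeault differential `∂ : Λ^{p,n-p} → Λ^{p+1,n-p}` of the complex manifold `(M, L)`: the
component of type `(p + 1, n - p)` of the de Rham differential. -/
def HypercomplexStructure.del (Q : HypercomplexStructure E M) (L : ImaginaryUnit) (p : ℕ) {n : ℕ}
    (η : DiffForm E M n) : DiffForm E M (n + 1) :=
  fun x => hodgePart (Q.act x L) (p + 1) (deRham η x)

/-- The quaternionic Dolbeault (Salamon) differential `d₊ : Λⁿ₊ → Λⁿ⁺¹₊`: the de Rham differential
followed by the projection onto the forms of maximal weight. -/
def HypercomplexStructure.dPlus (Q : HypercomplexStructure E M) {n : ℕ} (η : DiffForm E M n) :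
    DiffForm E M (n + 1) :=
  fun x => plusProj (Q.act x) (n + 1) (deRham η x)

/-- The metric is HKT (hyperkähler with torsion): `∂Ω = 0` for the `(2, 0)`-form
`Ω = (ω_J + √-1 ω_K) / 2` of the standard quaternions `I, J, K`. -/
def QuaternionicHermitianMetric.IsHKT (h : QuaternionicHermitianMetric Q) : Prop :=
  Q.del stdTriple.I 2 (h.Omega stdTriple) = 0

end Manifold

end Hypercomplex

end

/-! Everything is decided at one point. Integrability provides the Obata connection ∇: a symmetric
connection form for which every induced complex structure L is parallel (`exists_connection`). Hence
g = ∇h is a tensor whose values are symmetric bilinear forms with every L skew. As ∇ has no torsion,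
dω_L is the cyclic sum of g a b (L c) (`exists_tensor`). Both conditions thus become linear
conditions on the same g.

The form ∂Ω is the (3,0)-part of dΩ, and it equals (O(a,b,c) - √-1 O(Ia,b,c))/4 for the real
expression O called `obstruction`. So ∂Ω = 0 means O = 0 (`hodgePart_eq_zero_iff_obstruction`).

For d₊, let each quaternion q act on 3-forms by the derivation D_q. The operators H = -√-1 D_I and
E, F built from D_J, D_K form an `sl₂`-triple. H is p - q on forms of type (p,q), so only the
weights ±1, ±3 occur. The Casimir operator -(D_I² + D_J² + D_K²) has eigenvalue 15 on the weight 3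
part and 3 on the weight 1 part. Therefore d₊ω_I = 0 means that the Casimir operator acts on dω_I as
3, an explicit identity (`plusProj_eq_zero_iff`). Inserting quaternions into its arguments shows
that it is equivalent to O = 0 (`isLow_of_obstruction`, `obstruction_of_isLow`).

Finally, O = 0 survives the rotation of I, J, K to J, K, I (`obstruction_rotate`), and ω_L is linear
in L. So O = 0 for one triple gives d₊ω_L = 0 for every L, which makes the condition independent of
the triple. -/

noncomputable section

namespace Hypercomplex

/-! ### Representations of `sl₂` with weights `±1, ±3` -/

section SlTwo

variable {W : Type*} [AddCommGroup W] [Module ℂ W]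

/-- Three operators satisfying the relations of the standard basis of `sl₂`, such that only the
weights `±1` and `±3` occur. -/
structure SlTwoOperators (H E F : W →ₗ[ℂ] W) : Prop where
  weight_E (v : W) : H (E v) = E (H v) + (2 : ℂ) • E v
  weight_F (v : W) : H (F v) = F (H v) - (2 : ℂ) • F v
  comm (v : W) : E (F v) = F (E v) + H v
  quartic (v : W) : H (H (H (H v))) = (10 : ℂ) • H (H v) - (9 : ℂ) • v

/-- The Casimir operator of three operators `H, E, F`. -/
def casimir (H E F : W →ₗ[ℂ] W) : W →ₗ[ℂ] W :=
  H ∘ₗ H + (2 : ℂ) • (E ∘ₗ F) + (2 : ℂ) • (F ∘ₗ E)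

/-- A subspace that is stable under three operators. -/
structure IsStable (H E F : W →ₗ[ℂ] W) (U : Submodule ℂ W) : Prop where
  H_mem {v : W} : v ∈ U → H v ∈ U
  E_mem {v : W} : v ∈ U → E v ∈ U
  F_mem {v : W} : v ∈ U → F v ∈ U

/-- The eigenspace of the Casimir operator. -/
def casimirSpace (H E F : W →ₗ[ℂ] W) (c : ℂ) : Submodule ℂ W :=
  LinearMap.ker (casimir H E F - c • LinearMap.id)

namespace SlTwoOperators

variable {H E F : W →ₗ[ℂ] W}

theorem mem_casimirSpace {c : ℂ} {v : W} :
    v ∈ casimirSpace H E F c ↔ casimir H E F v = c • v := by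
  simp [casimirSpace, sub_eq_zero]

theorem casimir_apply (h : SlTwoOperators H E F) (v : W) :
    casimir H E F v = H (H v) + (2 : ℂ) • H v + (4 : ℂ) • F (E v) := by
  simp only [casimir, LinearMap.add_apply, LinearMap.smul_apply, LinearMap.comp_apply, h.comm]
  module

theorem eq_zero_of_smul_eq {a b : ℂ} (hab : a ≠ b) {v : W} (hv : a • v = b • v) : v = 0 := by
  by_contra hne
  exact hab (smul_left_injective ℂ hne hv)

/-- Otherwise `E v` would have weight 5, which is not a root of x⁴ = 10x² - 9: the two sides are 625
and 241. -/
theorem E_eq_zero_of_weight_three (h : SlTwoOperators H E F) {v : W} (hv : H v = (3 : ℂ) • v) :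
    E v = 0 := by
  have h1 : H (E v) = (5 : ℂ) • E v := by rw [h.weight_E, hv, map_smul]; module
  have h2 := h.quartic (E v)
  simp only [h1, map_smul] at h2
  refine eq_zero_of_smul_eq (a := 625) (b := 241) (by norm_num) ?_
  linear_combination (norm := module) h2

theorem F_eq_zero_of_weight_neg_three (h : SlTwoOperators H E F) {v : W}
    (hv : H v = (-3 : ℂ) • v) : F v = 0 := by
  have h1 : H (F v) = (-5 : ℂ) • F v := by rw [h.weight_F, hv, map_smul]; module
  have h2 := h.quartic (F v)
  simp only [h1, map_smul] at h2
  refine eq_zero_of_smul_eq (a := 625) (b := 241) (by norm_num) ?_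
  linear_combination (norm := module) h2

theorem casimir_H (h : SlTwoOperators H E F) (v : W) :
    casimir H E F (H v) = H (casimir H E F v) := by
  simp only [h.casimir_apply, map_add, map_smul, h.weight_E, h.weight_F]
  module

theorem casimir_E (h : SlTwoOperators H E F) (v : W) :
    casimir H E F (E v) = E (casimir H E F v) := by
  simp only [h.casimir_apply, map_add, map_smul, h.weight_E, h.comm]
  module

theorem casimir_F (h : SlTwoOperators H E F) (v : W) :
    casimir H E F (F v) = F (casimir H E F v) := by
  simp only [h.casimir_apply, map_add, map_smul, h.weight_F, map_sub, h.comm]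
  module

theorem isStable_casimirSpace (h : SlTwoOperators H E F) (c : ℂ) :
    IsStable H E F (casimirSpace H E F c) where
  H_mem hv := by
    rw [mem_casimirSpace] at hv ⊢; rw [h.casimir_H, hv, map_smul]
  E_mem hv := by
    rw [mem_casimirSpace] at hv ⊢; rw [h.casimir_E, hv, map_smul]
  F_mem hv := by
    rw [mem_casimirSpace] at hv ⊢; rw [h.casimir_F, hv, map_smul]

theorem exists_weight_decomposition (h : SlTwoOperators H E F) (v : W) :
    ∃ a b c d : W, v = a + b + c + d ∧ H a = (3 : ℂ) • a ∧ H b = (1 : ℂ) • b ∧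
      H c = (-1 : ℂ) • c ∧ H d = (-3 : ℂ) • d ∧
      ∀ U : Submodule ℂ W, IsStable H E F U → v ∈ U → a ∈ U ∧ b ∈ U ∧ c ∈ U ∧ d ∈ U := by
  -- Lagrange interpolation at the four roots 3, 1, -1, -3: the first component is (H+3)(H+1)(H-1)v
  -- / 48, and so on. Being polynomials in `H` applied to `v`, the components stay in every stable
  -- subspace containing `v`.
  refine ⟨(1 / 48 : ℂ) • (H (H (H v)) + (3 : ℂ) • H (H v) - H v - (3 : ℂ) • v),
    (-1 / 16 : ℂ) • (H (H (H v)) + H (H v) - (9 : ℂ) • H v - (9 : ℂ) • v),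
    (1 / 16 : ℂ) • (H (H (H v)) - H (H v) - (9 : ℂ) • H v + (9 : ℂ) • v),
    (-1 / 48 : ℂ) • (H (H (H v)) - (3 : ℂ) • H (H v) - H v + (3 : ℂ) • v), ?_, ?_, ?_, ?_, ?_, ?_⟩
  · module
  · simp only [map_smul, map_add, map_sub, h.quartic]; module
  · simp only [map_smul, map_add, map_sub, h.quartic]; module
  · simp only [map_smul, map_add, map_sub, h.quartic]; module
  · simp only [map_smul, map_add, map_sub, h.quartic]; module
  · intro U hU hv
    have h1 := hU.H_mem hv
    have h2 := hU.H_mem h1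
    have h3 := hU.H_mem h2
    have hs : ∀ {x : W} (c : ℂ), x ∈ U → c • x ∈ U := fun c hx => U.smul_mem c hx
    exact ⟨hs _ (U.sub_mem (U.sub_mem (U.add_mem h3 (hs _ h2)) h1) (hs _ hv)),
      hs _ (U.sub_mem (U.sub_mem (U.add_mem h3 h2) (hs _ h1)) (hs _ hv)),
      hs _ (U.add_mem (U.sub_mem (U.sub_mem h3 h2) (hs _ h1)) (hs _ hv)),
      hs _ (U.add_mem (U.sub_mem (U.sub_mem h3 (hs _ h2)) h1) (hs _ hv))⟩

/-- On vectors of weight `m` the Casimir operator is `m² + 2m + 4FE`. -/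
theorem F_E_of_weight (h : SlTwoOperators H E F) {m c : ℂ} {v : W} (hv : H v = m • v)
    (hc : v ∈ casimirSpace H E F c) : F (E v) = ((c - m ^ 2 - 2 * m) / 4) • v := by
  rw [mem_casimirSpace, h.casimir_apply] at hc
  simp only [hv, map_smul] at hc
  linear_combination (norm := module) (1 / 4 : ℂ) • hc

theorem weight_E_of_weight (h : SlTwoOperators H E F) {m : ℂ} {v : W} (hv : H v = m • v) :
    H (E v) = (m + 2) • E v := by
  rw [h.weight_E, hv, map_smul]; module

theorem weight_F_of_weight (h : SlTwoOperators H E F) {m : ℂ} {v : W} (hv : H v = m • v) :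
    H (F v) = (m - 2) • F v := by
  rw [h.weight_F, hv, map_smul]; module

theorem casimir_of_weight_three (h : SlTwoOperators H E F) {v : W} (hv : H v = (3 : ℂ) • v) :
    v ∈ casimirSpace H E F 15 := by
  rw [mem_casimirSpace, h.casimir_apply, h.E_eq_zero_of_weight_three hv]
  simp only [hv, map_smul, map_zero]
  module

theorem casimir_of_weight_neg_three (h : SlTwoOperators H E F) {v : W}
    (hv : H v = (-3 : ℂ) • v) : v ∈ casimirSpace H E F 15 := by
  have h1 := h.comm v
  rw [h.F_eq_zero_of_weight_neg_three hv, map_zero] at h1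
  rw [mem_casimirSpace, h.casimir_apply]
  have h2 : F (E v) = (3 : ℂ) • v := by
    linear_combination (norm := module) -h1 - hv
  simp only [h2, hv, map_smul]
  module

theorem disjoint_casimirSpace : Disjoint (casimirSpace H E F 15) (casimirSpace H E F 3) := by
  rw [Submodule.disjoint_def]
  intro v h1 h2
  rw [mem_casimirSpace] at h1 h2
  exact eq_zero_of_smul_eq (a := 15) (b := 3) (by norm_num) (h1.symm.trans h2)

/-- This is (C - 15)(C - 3) = 0 for the Casimir operator C. Weights ±3 have C = 15. On weight 1, C -
3 = 4FE passes through weight 3, and on weight -1, C - 3 = 4EF passes through weight -3; the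
eigenspace of 15 is stable under `E` and `F`. -/
theorem casimir_mul (h : SlTwoOperators H E F) (v : W) :
    casimir H E F v - (3 : ℂ) • v ∈ casimirSpace H E F 15 := by
  obtain ⟨a, b, c, d, rfl, ha, hb, hc, hd, -⟩ := h.exists_weight_decomposition v
  have key : ∀ {x : W}, x ∈ casimirSpace H E F 15 →
      casimir H E F x - (3 : ℂ) • x ∈ casimirSpace H E F 15 := by
    intro x hx
    rw [mem_casimirSpace.mp hx]
    exact Submodule.sub_mem _ (Submodule.smul_mem _ _ hx) (Submodule.smul_mem _ _ hx)
  have hb' : casimir H E F b - (3 : ℂ) • b ∈ casimirSpace H E F 15 := by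
    have h1 : casimir H E F b - (3 : ℂ) • b = (4 : ℂ) • F (E b) := by
      rw [h.casimir_apply]
      simp only [hb, map_smul]
      module
    rw [h1]
    refine Submodule.smul_mem _ _ ((h.isStable_casimirSpace 15).F_mem (h.casimir_of_weight_three ?_))
    rw [h.weight_E_of_weight hb]; norm_num
  have hc' : casimir H E F c - (3 : ℂ) • c ∈ casimirSpace H E F 15 := by
    have h1 : casimir H E F c - (3 : ℂ) • c = (4 : ℂ) • E (F c) := by
      rw [h.casimir_apply, h.comm]
      simp only [hc, map_smul]
      module
    rw [h1]
    refine Submodule.smul_mem _ _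
      ((h.isStable_casimirSpace 15).E_mem (h.casimir_of_weight_neg_three ?_))
    rw [h.weight_F_of_weight hc]; norm_num
  have h1 := Submodule.add_mem _ (Submodule.add_mem _ (Submodule.add_mem _
    (key (h.casimir_of_weight_three ha)) hb') hc') (key (h.casimir_of_weight_neg_three hd))
  convert h1 using 1
  simp only [map_add]
  module

theorem isCompl_casimirSpace (h : SlTwoOperators H E F) :
    IsCompl (casimirSpace H E F 15) (casimirSpace H E F 3) := by
  refine ⟨disjoint_casimirSpace, ?_⟩
  rw [codisjoint_iff, eq_top_iff]
  intro v _
  have h1 := h.casimir_mul v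
  refine Submodule.mem_sup.mpr ⟨(1 / 12 : ℂ) • (casimir H E F v - (3 : ℂ) • v),
    Submodule.smul_mem _ _ h1, (-1 / 12 : ℂ) • (casimir H E F v - (15 : ℂ) • v), ?_, ?_⟩
  · refine Submodule.smul_mem _ _ ?_
    rw [mem_casimirSpace] at h1 ⊢
    simp only [map_sub, map_smul] at h1 ⊢
    linear_combination (norm := module) h1
  · module

/-- The subspace generated by a highest weight vector of weight `3`. -/
def spanFour (F : W →ₗ[ℂ] W) (α : W) : Submodule ℂ W :=
  Submodule.span ℂ (Set.range ![α, F α, F (F α), F (F (F α))])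

/-- The subspace generated by a highest weight vector of weight `1`. -/
def spanTwo (F : W →ₗ[ℂ] W) (α : W) : Submodule ℂ W :=
  Submodule.span ℂ (Set.range ![α, F α])

theorem isStable_span {ι : Type*} {x : ι → W}
    (hH : ∀ i, H (x i) ∈ Submodule.span ℂ (Set.range x))
    (hE : ∀ i, E (x i) ∈ Submodule.span ℂ (Set.range x))
    (hF : ∀ i, F (x i) ∈ Submodule.span ℂ (Set.range x)) :
    IsStable H E F (Submodule.span ℂ (Set.range x)) := by
  have key : ∀ T : W →ₗ[ℂ] W, (∀ i, T (x i) ∈ Submodule.span ℂ (Set.range x)) →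
      ∀ {v}, v ∈ Submodule.span ℂ (Set.range x) → T v ∈ Submodule.span ℂ (Set.range x) := by
    intro T hT v hv
    have : Submodule.span ℂ (Set.range x) ≤ (Submodule.span ℂ (Set.range x)).comap T := by
      rw [Submodule.span_le]
      rintro _ ⟨i, rfl⟩
      exact hT i
    exact this hv
  exact ⟨key H hH, key E hE, key F hF⟩

theorem spanFour_le {U : Submodule ℂ W} (hU : IsStable H E F U) {α : W} (hα : α ∈ U) :
    spanFour F α ≤ U := by
  have h1 := hU.F_mem hα
  have h2 := hU.F_mem h1
  have h3 := hU.F_mem h2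
  rw [spanFour, Submodule.span_le]
  rintro _ ⟨i, rfl⟩
  fin_cases i <;> assumption

theorem spanTwo_le {U : Submodule ℂ W} (hU : IsStable H E F U) {α : W} (hα : α ∈ U) :
    spanTwo F α ≤ U := by
  have h1 := hU.F_mem hα
  rw [spanTwo, Submodule.span_le]
  rintro _ ⟨i, rfl⟩
  fin_cases i <;> assumption

/-- The action of `E` on the vectors `α, Fα, F²α, F³α`, and their weights. -/
theorem string_four (h : SlTwoOperators H E F) {α : W} (hα : H α = (3 : ℂ) • α) :
    H (F α) = (1 : ℂ) • F α ∧ H (F (F α)) = (-1 : ℂ) • F (F α) ∧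
      H (F (F (F α))) = (-3 : ℂ) • F (F (F α)) ∧ E α = 0 ∧ E (F α) = (3 : ℂ) • α ∧
      E (F (F α)) = (4 : ℂ) • F α ∧ E (F (F (F α))) = (3 : ℂ) • F (F α) ∧
      F (F (F (F α))) = 0 := by
  have h1 : H (F α) = (1 : ℂ) • F α := by rw [h.weight_F_of_weight hα]; norm_num
  have h2 : H (F (F α)) = (-1 : ℂ) • F (F α) := by rw [h.weight_F_of_weight h1]; norm_num
  have h3 : H (F (F (F α))) = (-3 : ℂ) • F (F (F α)) := by
    rw [h.weight_F_of_weight h2]; norm_num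
  have e0 := h.E_eq_zero_of_weight_three hα
  have e1 : E (F α) = (3 : ℂ) • α := by rw [h.comm, e0, map_zero, zero_add, hα]
  have e2 : E (F (F α)) = (4 : ℂ) • F α := by rw [h.comm, e1, map_smul, h1]; module
  have e3 : E (F (F (F α))) = (3 : ℂ) • F (F α) := by rw [h.comm, e2, map_smul, h2]; module
  exact ⟨h1, h2, h3, e0, e1, e2, e3, h.F_eq_zero_of_weight_neg_three h3⟩

theorem isStable_spanFour (h : SlTwoOperators H E F) {α : W} (hα : H α = (3 : ℂ) • α) :
    IsStable H E F (spanFour F α) := by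
  obtain ⟨h1, h2, h3, e0, e1, e2, e3, f4⟩ := h.string_four hα
  have m : ∀ i, ![α, F α, F (F α), F (F (F α))] i ∈
    Submodule.span ℂ (Set.range ![α, F α, F (F α), F (F (F α))]) :=
    fun i => Submodule.subset_span ⟨i, rfl⟩
  have m0 := m 0
  have m1 := m 1
  have m2 := m 2
  have m3 := m 3
  refine isStable_span ?_ ?_ ?_ <;> intro i <;> fin_cases i
  · exact hα ▸ Submodule.smul_mem _ _ m0
  · exact h1 ▸ Submodule.smul_mem _ _ m1
  · exact h2 ▸ Submodule.smul_mem _ _ m2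
  · exact h3 ▸ Submodule.smul_mem _ _ m3
  · exact e0 ▸ Submodule.zero_mem _
  · exact e1 ▸ Submodule.smul_mem _ _ m0
  · exact e2 ▸ Submodule.smul_mem _ _ m1
  · exact e3 ▸ Submodule.smul_mem _ _ m2
  · exact m1
  · exact m2
  · exact m3
  · exact f4 ▸ Submodule.zero_mem _

theorem finrank_spanFour (h : SlTwoOperators H E F) {α : W} (hα : H α = (3 : ℂ) • α)
    (hne : α ≠ 0) : Module.finrank ℂ (spanFour F α) = 4 := by
  obtain ⟨h1, h2, h3, e0, e1, e2, e3, f4⟩ := h.string_four hα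
  have n1 : F α ≠ 0 := by
    intro h0; rw [h0, map_zero] at e1; exact hne (by simpa using e1.symm)
  have n2 : F (F α) ≠ 0 := by
    intro h0; rw [h0, map_zero] at e2; exact n1 (by simpa using e2.symm)
  have n3 : F (F (F α)) ≠ 0 := by
    intro h0; rw [h0, map_zero] at e3; exact n2 (by simpa using e3.symm)
  have hli := Module.End.eigenvectors_linearIndependent' H (![3, 1, -1, -3] : Fin 4 → ℂ)
    (by
      intro i j hij
      fin_cases i <;> fin_cases j <;> first | rfl | (exfalso; norm_num at hij))
    ![α, F α, F (F α), F (F (F α))] (by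
      intro i
      rw [Module.End.hasEigenvector_iff, Module.End.mem_eigenspace_iff]
      fin_cases i
      exacts [⟨hα, hne⟩, ⟨h1, n1⟩, ⟨h2, n2⟩, ⟨h3, n3⟩])
  exact (finrank_span_eq_card hli).trans (Fintype.card_fin _)

/-- The vectors `α, Fα` for `α` of weight `1` in the eigenspace of eigenvalue `3`. -/
theorem string_two (h : SlTwoOperators H E F) {α : W} (hα : H α = (1 : ℂ) • α)
    (hc : α ∈ casimirSpace H E F 3) :
    H (F α) = (-1 : ℂ) • F α ∧ E α = 0 ∧ E (F α) = α ∧ F (F α) = 0 := by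
  have h1 : H (F α) = (-1 : ℂ) • F α := by rw [h.weight_F_of_weight hα]; norm_num
  have hs := h.isStable_casimirSpace 3
  have h2 : H (F (F α)) = (-3 : ℂ) • F (F α) := by rw [h.weight_F_of_weight h1]; norm_num
  have h3 : H (E α) = (3 : ℂ) • E α := by rw [h.weight_E_of_weight hα]; norm_num
  have e0 : E α = 0 := Submodule.disjoint_def.mp (disjoint_casimirSpace (H := H) (E := E) (F := F))
    _ (h.casimir_of_weight_three h3) (hs.E_mem hc)
  have f2 : F (F α) = 0 :=
    Submodule.disjoint_def.mp (disjoint_casimirSpace (H := H) (E := E) (F := F))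
      _ (h.casimir_of_weight_neg_three h2) (hs.F_mem (hs.F_mem hc))
  exact ⟨h1, e0, by rw [h.comm, e0, map_zero, zero_add, hα, one_smul], f2⟩

theorem isStable_spanTwo (h : SlTwoOperators H E F) {α : W} (hα : H α = (1 : ℂ) • α)
    (hc : α ∈ casimirSpace H E F 3) : IsStable H E F (spanTwo F α) := by
  obtain ⟨h1, e0, e1, f2⟩ := h.string_two hα hc
  have m : ∀ i, ![α, F α] i ∈ Submodule.span ℂ (Set.range ![α, F α]) :=
    fun i => Submodule.subset_span ⟨i, rfl⟩
  have m0 := m 0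
  have m1 := m 1
  refine isStable_span ?_ ?_ ?_ <;> intro i <;> fin_cases i
  · exact hα ▸ Submodule.smul_mem _ _ m0
  · exact h1 ▸ Submodule.smul_mem _ _ m1
  · exact e0 ▸ Submodule.zero_mem _
  · exact e1.symm ▸ m0
  · exact m1
  · exact f2 ▸ Submodule.zero_mem _

theorem finrank_spanTwo (h : SlTwoOperators H E F) {α : W} (hα : H α = (1 : ℂ) • α)
    (hc : α ∈ casimirSpace H E F 3) (hne : α ≠ 0) : Module.finrank ℂ (spanTwo F α) = 2 := by
  obtain ⟨h1, e0, e1, f2⟩ := h.string_two hα hc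
  have n1 : F α ≠ 0 := by
    intro h0; rw [h0, map_zero] at e1; exact hne e1.symm
  have hli := Module.End.eigenvectors_linearIndependent' H (![1, -1] : Fin 2 → ℂ)
    (by
      intro i j hij
      fin_cases i <;> fin_cases j <;> first | rfl | (exfalso; norm_num at hij))
    ![α, F α] (by
      intro i
      rw [Module.End.hasEigenvector_iff, Module.End.mem_eigenspace_iff]
      fin_cases i
      exacts [⟨hα, hne⟩, ⟨h1, n1⟩])
  exact (finrank_span_eq_card hli).trans (Fintype.card_fin _)

theorem E_ne_zero_of_weight (h : SlTwoOperators H E F) {m c : ℂ} {v : W} (hv : H v = m • v)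
    (hc : v ∈ casimirSpace H E F c) (hm : (c - m ^ 2 - 2 * m) / 4 ≠ 0) (hne : v ≠ 0) :
    E v ≠ 0 := by
  intro h0
  have h1 := h.F_E_of_weight hv hc
  rw [h0, map_zero] at h1
  exact hne ((smul_eq_zero.mp h1.symm).resolve_left hm)

/-- Any nonzero weight vector can be raised to weight 3, since FE acts on the weights 1, -1, -3 of
this eigenspace as the nonzero scalars 3, 4, 3. -/
theorem exists_weight_three (h : SlTwoOperators H E F) {U : Submodule ℂ W}
    (hU : IsStable H E F U) (hle : U ≤ casimirSpace H E F 15) (hne : U ≠ ⊥) :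
    ∃ α ∈ U, α ≠ 0 ∧ H α = (3 : ℂ) • α := by
  obtain ⟨v, hv, hv0⟩ := Submodule.exists_mem_ne_zero_of_ne_bot hne
  obtain ⟨a, b, c, d, rfl, ha, hb, hc, hd, hmem⟩ := h.exists_weight_decomposition v
  obtain ⟨ma, mb, mc, md⟩ := hmem U hU hv
  have one : ∀ {x : W}, x ∈ U → H x = (1 : ℂ) • x → x ≠ 0 →
      ∃ α ∈ U, α ≠ 0 ∧ H α = (3 : ℂ) • α := fun {x} hx hw h0 =>
    ⟨E x, hU.E_mem hx, h.E_ne_zero_of_weight hw (hle hx) (by norm_num) h0, by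
      rw [h.weight_E_of_weight hw]; norm_num⟩
  have two : ∀ {x : W}, x ∈ U → H x = (-1 : ℂ) • x → x ≠ 0 →
      ∃ α ∈ U, α ≠ 0 ∧ H α = (3 : ℂ) • α := fun {x} hx hw h0 =>
    one (hU.E_mem hx) (by rw [h.weight_E_of_weight hw]; norm_num)
      (h.E_ne_zero_of_weight hw (hle hx) (by norm_num) h0)
  by_cases a0 : a = 0
  · by_cases b0 : b = 0
    · by_cases c0 : c = 0
      · have d0 : d ≠ 0 := by simpa [a0, b0, c0] using hv0
        exact two (hU.E_mem md) (by rw [h.weight_E_of_weight hd]; norm_num)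
          (h.E_ne_zero_of_weight hd (hle md) (by norm_num) d0)
      · exact two mc hc c0
    · exact one mb hb b0
  · exact ⟨a, ma, a0, ha⟩

theorem exists_weight_one (h : SlTwoOperators H E F) {U : Submodule ℂ W}
    (hU : IsStable H E F U) (hle : U ≤ casimirSpace H E F 3) (hne : U ≠ ⊥) :
    ∃ α ∈ U, α ≠ 0 ∧ H α = (1 : ℂ) • α := by
  obtain ⟨v, hv, hv0⟩ := Submodule.exists_mem_ne_zero_of_ne_bot hne
  obtain ⟨a, b, c, d, rfl, ha, hb, hc, hd, hmem⟩ := h.exists_weight_decomposition v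
  obtain ⟨ma, mb, mc, md⟩ := hmem U hU hv
  have hdis := Submodule.disjoint_def.mp (disjoint_casimirSpace (H := H) (E := E) (F := F))
  have a0 : a = 0 := hdis _ (h.casimir_of_weight_three ha) (hle ma)
  have d0 : d = 0 := hdis _ (h.casimir_of_weight_neg_three hd) (hle md)
  by_cases b0 : b = 0
  · have c0 : c ≠ 0 := by simpa [a0, b0, d0] using hv0
    exact ⟨E c, hU.E_mem mc, h.E_ne_zero_of_weight hc (hle mc) (by norm_num) c0, by
      rw [h.weight_E_of_weight hc]; norm_num⟩
  · exact ⟨b, mb, b0, hb⟩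

theorem four_le_finrank (h : SlTwoOperators H E F) {U : Submodule ℂ W} [FiniteDimensional ℂ U]
    (hU : IsStable H E F U) (hle : U ≤ casimirSpace H E F 15) (hne : U ≠ ⊥) :
    4 ≤ Module.finrank ℂ U := by
  obtain ⟨α, hα, h0, hw⟩ := h.exists_weight_three hU hle hne
  rw [← h.finrank_spanFour hw h0]
  exact Submodule.finrank_mono (spanFour_le hU hα)

theorem two_le_finrank (h : SlTwoOperators H E F) {U : Submodule ℂ W} [FiniteDimensional ℂ U]
    (hU : IsStable H E F U) (hle : U ≤ casimirSpace H E F 3) (hne : U ≠ ⊥) :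
    2 ≤ Module.finrank ℂ U := by
  obtain ⟨α, hα, h0, hw⟩ := h.exists_weight_one hU hle hne
  rw [← h.finrank_spanTwo hw (hle hα) h0]
  exact Submodule.finrank_mono (spanTwo_le hU hα)

/-- A vector of weight below 3 is recovered from its image under `E` by applying `F`, up to a
nonzero scalar. Descending from weight 3, all weight vectors therefore lie in strings generated by
highest weight vectors. -/
theorem mem_of_casimir_fifteen (h : SlTwoOperators H E F) {v : W}
    (hv : v ∈ casimirSpace H E F 15) (P : Submodule ℂ W)
    (hP : ∀ α, H α = (3 : ℂ) • α → spanFour F α ≤ P) : v ∈ P := by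
  obtain ⟨a, b, c, d, rfl, ha, hb, hc, hd, hmem⟩ := h.exists_weight_decomposition v
  obtain ⟨-, mb, mc, md⟩ := hmem _ (h.isStable_casimirSpace 15) hv
  have hs := h.isStable_casimirSpace 15
  have s : ∀ α, H α = (3 : ℂ) • α → α ∈ P ∧ F α ∈ P ∧ F (F α) ∈ P ∧ F (F (F α)) ∈ P := by
    intro α hα
    have m : ∀ i, ![α, F α, F (F α), F (F (F α))] i ∈ P :=
      fun i => hP α hα (Submodule.subset_span ⟨i, rfl⟩)
    exact ⟨m 0, m 1, m 2, m 3⟩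
  have one : ∀ {x : W}, x ∈ casimirSpace H E F 15 → H x = (1 : ℂ) • x →
      x ∈ P ∧ F x ∈ P ∧ F (F x) ∈ P := by
    intro x hx hw
    have h1 := h.F_E_of_weight hw hx
    obtain ⟨-, s1, s2, s3⟩ := s (E x) (by rw [h.weight_E_of_weight hw]; norm_num)
    rw [h1] at s1 s2 s3
    simp only [map_smul] at s2 s3
    rw [Submodule.smul_mem_iff _ (by norm_num)] at s1 s2 s3
    exact ⟨s1, s2, s3⟩
  have two : ∀ {x : W}, x ∈ casimirSpace H E F 15 → H x = (-1 : ℂ) • x → x ∈ P ∧ F x ∈ P := by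
    intro x hx hw
    have h1 := h.F_E_of_weight hw hx
    obtain ⟨-, s1, s2⟩ := one (hs.E_mem hx) (by rw [h.weight_E_of_weight hw]; norm_num)
    rw [h1] at s1 s2
    simp only [map_smul] at s2
    rw [Submodule.smul_mem_iff _ (by norm_num)] at s1 s2
    exact ⟨s1, s2⟩
  have three : d ∈ P := by
    have h1 := h.F_E_of_weight hd md
    obtain ⟨-, s1⟩ := two (hs.E_mem md) (by rw [h.weight_E_of_weight hd]; norm_num)
    rw [h1] at s1
    rwa [Submodule.smul_mem_iff _ (by norm_num)] at s1
  exact P.add_mem (P.add_mem (P.add_mem (s a ha).1 (one mb hb).1) (two mc hc).1) three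

theorem mem_of_casimir_three (h : SlTwoOperators H E F) {v : W}
    (hv : v ∈ casimirSpace H E F 3) (P : Submodule ℂ W)
    (hP : ∀ α, H α = (1 : ℂ) • α → α ∈ casimirSpace H E F 3 → spanTwo F α ≤ P) : v ∈ P := by
  obtain ⟨a, b, c, d, rfl, ha, hb, hc, hd, hmem⟩ := h.exists_weight_decomposition v
  have hs := h.isStable_casimirSpace 3
  obtain ⟨ma, mb, mc, md⟩ := hmem _ hs hv
  have hdis := Submodule.disjoint_def.mp (disjoint_casimirSpace (H := H) (E := E) (F := F))
  have a0 : a = 0 := hdis _ (h.casimir_of_weight_three ha) ma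
  have d0 : d = 0 := hdis _ (h.casimir_of_weight_neg_three hd) md
  have s : ∀ α, H α = (1 : ℂ) • α → α ∈ casimirSpace H E F 3 → α ∈ P ∧ F α ∈ P := by
    intro α hα hα'
    have m : ∀ i, ![α, F α] i ∈ P := fun i => hP α hα hα' (Submodule.subset_span ⟨i, rfl⟩)
    exact ⟨m 0, m 1⟩
  have hc' : c ∈ P := by
    have h1 := h.F_E_of_weight hc mc
    obtain ⟨-, s1⟩ := s (E c) (by rw [h.weight_E_of_weight hc]; norm_num) (hs.E_mem mc)
    rw [h1] at s1
    rwa [Submodule.smul_mem_iff _ (by norm_num)] at s1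
  rw [a0, d0, zero_add, add_zero]
  exact P.add_mem (s b hb mb).1 hc'

end SlTwoOperators

end SlTwo

/-! ### Isotypic decomposition of a representation of the unit quaternions -/

section Isotypic

/-- Turns irreducibility of `U` as a representation of its own into a condition on submodules of the
ambient space, where the operators act. -/
theorem isIrreducible_iff {G W : Type*} [Monoid G] [AddCommGroup W] [Module ℂ W]
    {ρ : Representation ℂ G W} (U : Subrepresentation ρ) :
    U.toRepresentation.IsIrreducible ↔ U.toSubmodule ≠ ⊥ ∧
      ∀ V : Subrepresentation ρ, V.toSubmodule ≤ U.toSubmodule →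
        V.toSubmodule = ⊥ ∨ V.toSubmodule = U.toSubmodule := by
  rw [Representation.IsIrreducible, isSimpleOrder_iff]
  refine and_congr ?_ ⟨fun h V hV => ?_, fun h S => ?_⟩
  · rw [← not_subsingleton_iff_nontrivial, ne_eq, not_iff_not]
    rw [← subsingleton_iff_bot_eq_top, ← Submodule.subsingleton_iff_eq_bot,
      ← Submodule.subsingleton_iff ℂ, ← subsingleton_iff_bot_eq_top]
    exact ⟨fun h => congrArg Subrepresentation.toSubmodule h,
      fun h => Subrepresentation.toSubmodule_injective h⟩
  · let S : Subrepresentation U.toRepresentation :=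
      ⟨V.toSubmodule.comap U.toSubmodule.subtype, fun g v hv => V.apply_mem_toSubmodule g hv⟩
    rcases h S with h0 | h0
    · left
      have h1 : V.toSubmodule.comap U.toSubmodule.subtype = ⊥ :=
        congrArg Subrepresentation.toSubmodule h0
      exact (Submodule.disjoint_iff_comap_eq_bot.mpr h1).symm.eq_bot_of_le hV
    · right
      have h1 : V.toSubmodule.comap U.toSubmodule.subtype = ⊤ :=
        congrArg Subrepresentation.toSubmodule h0
      exact le_antisymm hV (Submodule.comap_subtype_eq_top.mp h1)
  · let V : Subrepresentation ρ :=
      ⟨S.toSubmodule.map U.toSubmodule.subtype, by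
        rintro g _ ⟨v, hv, rfl⟩
        exact ⟨_, S.apply_mem_toSubmodule g hv, rfl⟩⟩
    rcases h V (Submodule.map_subtype_le _ _) with h0 | h0
    · left
      refine Subrepresentation.toSubmodule_injective ?_
      refine Submodule.map_injective_of_injective U.toSubmodule.injective_subtype ?_
      exact h0.trans (Submodule.map_bot _).symm
    · right
      refine Subrepresentation.toSubmodule_injective ?_
      have h1 : S.toSubmodule.map U.toSubmodule.subtype = U.toSubmodule := h0
      refine Submodule.map_injective_of_injective U.toSubmodule.injective_subtype ?_
      rw [h1]
      exact (Submodule.map_subtype_top _).symm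

variable {W : Type*} [AddCommGroup W] [Module ℂ W] {H E F : W →ₗ[ℂ] W}
  {ρ : Representation ℂ (unitary ℍ[ℝ]) W}

namespace SlTwoOperators

/-- Schur-type argument: the intersection of `U` with the eigenspace of 15 is invariant, hence all
of `U` or zero. If it is zero, `casimir_mul` forces C - 3 to vanish on `U`. -/
theorem le_casimirSpace_or (h : SlTwoOperators H E F)
    (hst : ∀ U : Submodule ℂ W, (∀ g, ∀ v ∈ U, ρ g v ∈ U) ↔ IsStable H E F U)
    (U : Subrepresentation ρ) (hU : U.toRepresentation.IsIrreducible) :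
    U.toSubmodule ≤ casimirSpace H E F 15 ∨ U.toSubmodule ≤ casimirSpace H E F 3 := by
  rw [isIrreducible_iff] at hU
  have hs : IsStable H E F U.toSubmodule := (hst _).mp fun g v hv => U.apply_mem_toSubmodule g hv
  have h15 := h.isStable_casimirSpace 15
  have hi : IsStable H E F (U.toSubmodule ⊓ casimirSpace H E F 15) :=
    ⟨fun hv => ⟨hs.H_mem hv.1, h15.H_mem hv.2⟩, fun hv => ⟨hs.E_mem hv.1, h15.E_mem hv.2⟩,
      fun hv => ⟨hs.F_mem hv.1, h15.F_mem hv.2⟩⟩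
  rcases hU.2 ⟨_, (hst _).mpr hi⟩ inf_le_left with h0 | h0
  · right
    intro v hv
    have h1 : casimir H E F v - (3 : ℂ) • v ∈ U.toSubmodule ⊓ casimirSpace H E F 15 := by
      refine ⟨U.toSubmodule.sub_mem ?_ (U.toSubmodule.smul_mem _ hv), h.casimir_mul v⟩
      rw [h.casimir_apply]
      exact U.toSubmodule.add_mem (U.toSubmodule.add_mem (hs.H_mem (hs.H_mem hv))
        (U.toSubmodule.smul_mem _ (hs.H_mem hv))) (U.toSubmodule.smul_mem _ (hs.F_mem (hs.E_mem hv)))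
    have h2 : U.toSubmodule ⊓ casimirSpace H E F 15 = ⊥ := h0
    rw [h2, Submodule.mem_bot, sub_eq_zero] at h1
    exact mem_casimirSpace.mpr h1
  · left
    have h2 : U.toSubmodule ⊓ casimirSpace H E F 15 = U.toSubmodule := h0
    exact inf_eq_left.mp h2

/-- An irreducible subspace in the eigenspace of 3 contains, hence equals, a two-dimensional string,
so dimension 4 excludes it. Conversely the strings of length four span the eigenspace of 15, and
each is irreducible because every nonzero stable subspace there has dimension at least 4. -/
theorem weightSubspace_three (h : SlTwoOperators H E F)
    (hst : ∀ U : Submodule ℂ W, (∀ g, ∀ v ∈ U, ρ g v ∈ U) ↔ IsStable H E F U) :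
    weightSubspace ρ 3 = casimirSpace H E F 15 := by
  apply le_antisymm
  · refine iSup₂_le fun U hU => ?_
    rcases h.le_casimirSpace_or hst U hU.1 with h1 | h1
    · exact h1
    · exfalso
      have hirr := (isIrreducible_iff U).mp hU.1
      have hs : IsStable H E F U.toSubmodule :=
        (hst _).mp fun g v hv => U.apply_mem_toSubmodule g hv
      obtain ⟨α, hα, h0, hw⟩ := h.exists_weight_one hs h1 hirr.1
      have hst2 := h.isStable_spanTwo hw (h1 hα)
      have hf := h.finrank_spanTwo hw (h1 hα) h0
      rcases hirr.2 ⟨_, (hst _).mpr hst2⟩ (spanTwo_le hs hα) with h2 | h2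
      · have h2' : spanTwo F α = ⊥ := h2
        rw [h2', finrank_bot] at hf
        omega
      · have h2' : spanTwo F α = U.toSubmodule := h2
        have := hU.2
        rw [← h2', hf] at this
        omega
  · intro v hv
    refine h.mem_of_casimir_fifteen hv _ fun α hα => ?_
    by_cases h0 : α = 0
    · rw [h0, spanFour, Submodule.span_le]
      rintro _ ⟨i, rfl⟩
      fin_cases i <;> simp
    have hs := h.isStable_spanFour hα
    have hf := h.finrank_spanFour hα h0
    have hle : spanFour F α ≤ casimirSpace H E F 15 :=
      spanFour_le (h.isStable_casimirSpace 15) (h.casimir_of_weight_three hα)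
    have : FiniteDimensional ℂ (spanFour F α) := Module.finite_of_finrank_pos (by omega)
    let U : Subrepresentation ρ := ⟨spanFour F α, (hst _).mpr hs⟩
    refine le_iSup₂_of_le U ⟨(isIrreducible_iff U).mpr ⟨?_, fun V hV => ?_⟩, hf⟩ le_rfl
    · intro hb
      have hb' : spanFour F α = ⊥ := hb
      rw [hb', finrank_bot] at hf
      omega
    · rw [or_iff_not_imp_left]
      intro hne
      have hV' : V.toSubmodule ≤ spanFour F α := hV
      have : FiniteDimensional ℂ V.toSubmodule := Submodule.finiteDimensional_of_le hV'
      refine Submodule.eq_of_le_of_finrank_le hV' ?_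
      rw [hf]
      exact h.four_le_finrank ((hst _).mp fun g v hv => V.apply_mem_toSubmodule g hv)
        (hV'.trans hle) hne

/-- Weight below 3 means dimension at most 3, too small for the eigenspace of 15. Conversely the
two-dimensional strings, of weight 1, span the eigenspace of 3. -/
theorem iSup_weightSubspace_lt_three (h : SlTwoOperators H E F)
    (hst : ∀ U : Submodule ℂ W, (∀ g, ∀ v ∈ U, ρ g v ∈ U) ↔ IsStable H E F U) :
    ⨆ k ∈ Set.Iio 3, weightSubspace ρ k = casimirSpace H E F 3 := by
  apply le_antisymm
  · refine iSup₂_le fun k hk => iSup₂_le fun U hU => ?_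
    rcases h.le_casimirSpace_or hst U hU.1 with h1 | h1
    · exfalso
      have hs : IsStable H E F U.toSubmodule :=
        (hst _).mp fun g v hv => U.apply_mem_toSubmodule g hv
      have : FiniteDimensional ℂ U.toSubmodule :=
        Module.finite_of_finrank_pos (by rw [hU.2]; omega)
      have := h.four_le_finrank hs h1 ((isIrreducible_iff U).mp hU.1).1
      rw [hU.2] at this
      have : k < 3 := hk
      omega
    · exact h1
  · intro v hv
    refine h.mem_of_casimir_three hv _ fun α hα hαc => ?_
    by_cases h0 : α = 0
    · rw [h0, spanTwo, Submodule.span_le]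
      rintro _ ⟨i, rfl⟩
      fin_cases i <;> simp
    have hs := h.isStable_spanTwo hα hαc
    have hf := h.finrank_spanTwo hα hαc h0
    have hle : spanTwo F α ≤ casimirSpace H E F 3 := spanTwo_le (h.isStable_casimirSpace 3) hαc
    have : FiniteDimensional ℂ (spanTwo F α) := Module.finite_of_finrank_pos (by omega)
    let U : Subrepresentation ρ := ⟨spanTwo F α, (hst _).mpr hs⟩
    refine le_iSup₂_of_le 1 (by simp) ?_
    refine le_iSup₂_of_le U ⟨(isIrreducible_iff U).mpr ⟨?_, fun V hV => ?_⟩, hf⟩ le_rfl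
    · intro hb
      have hb' : spanTwo F α = ⊥ := hb
      rw [hb', finrank_bot] at hf
      omega
    · rw [or_iff_not_imp_left]
      intro hne
      have hV' : V.toSubmodule ≤ spanTwo F α := hV
      have : FiniteDimensional ℂ V.toSubmodule := Submodule.finiteDimensional_of_le hV'
      refine Submodule.eq_of_le_of_finrank_le hV' ?_
      rw [hf]
      exact h.two_le_finrank ((hst _).mp fun g v hv => V.apply_mem_toSubmodule g hv)
        (hV'.trans hle) hne

end SlTwoOperators

end Isotypic

/-! ### Imaginary quaternions and standard triples -/

section Triple

theorem ImaginaryUnit.re_eq_zero (L : ImaginaryUnit) : (L : ℍ[ℝ]).re = 0 := by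
  have h := L.sq_eq
  have h0 := congrArg QuaternionAlgebra.re h
  have h1 := congrArg QuaternionAlgebra.imI h
  have h2 := congrArg QuaternionAlgebra.imJ h
  have h3 := congrArg QuaternionAlgebra.imK h
  simp only [Quaternion.re_mul, Quaternion.imI_mul, Quaternion.imJ_mul, Quaternion.imK_mul,
    Quaternion.re_neg, Quaternion.imI_neg, Quaternion.imJ_neg, Quaternion.imK_neg,
    Quaternion.re_one, Quaternion.imI_one, Quaternion.imJ_one, Quaternion.imK_one] at h0 h1 h2 h3
  by_contra hne
  have e1 : (L : ℍ[ℝ]).imI = 0 := by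
    refine (mul_eq_zero.mp (?_ : (L : ℍ[ℝ]).re * (L : ℍ[ℝ]).imI = 0)).resolve_left hne
    linarith
  have e2 : (L : ℍ[ℝ]).imJ = 0 := by
    refine (mul_eq_zero.mp (?_ : (L : ℍ[ℝ]).re * (L : ℍ[ℝ]).imJ = 0)).resolve_left hne
    linarith
  have e3 : (L : ℍ[ℝ]).imK = 0 := by
    refine (mul_eq_zero.mp (?_ : (L : ℍ[ℝ]).re * (L : ℍ[ℝ]).imK = 0)).resolve_left hne
    linarith
  rw [e1, e2, e3] at h0
  nlinarith [mul_self_nonneg (L : ℍ[ℝ]).re]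

theorem mul_self_of_re_eq_zero {q : ℍ[ℝ]} (hq : q.re = 0) :
    q * q = ((-Quaternion.normSq q : ℝ) : ℍ[ℝ]) := by
  have h : star q = -q := by
    rw [Quaternion.star_eq_neg]; exact hq
  have h1 := Quaternion.self_mul_star q
  rw [h, mul_neg] at h1
  rw [Quaternion.coe_neg, ← h1, neg_neg]

theorem anticommute_of_re_eq_zero {p q : ℍ[ℝ]} (hp : p.re = 0) (hq : q.re = 0)
    (h : (p * q).re = 0) : p * q = -(q * p) := by
  rw [Quaternion.re_mul, hp, hq] at h
  ext <;> simp [hp, hq] <;> linarith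

namespace QuaternionTriple

variable (t : QuaternionTriple)

theorem I_mul_I : (t.I : ℍ[ℝ]) * t.I = -1 := t.I.sq_eq
theorem J_mul_J : (t.J : ℍ[ℝ]) * t.J = -1 := t.J.sq_eq
theorem K_mul_K : (t.K : ℍ[ℝ]) * t.K = -1 := t.K.sq_eq

theorem J_mul_I : (t.J : ℍ[ℝ]) * t.I = -(t.K : ℍ[ℝ]) := by
  rw [anticommute_of_re_eq_zero t.J.re_eq_zero t.I.re_eq_zero, t.mul_eq]
  have h : ((t.I : ℍ[ℝ]) * t.J).re = 0 := by rw [t.mul_eq, t.K.re_eq_zero]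
  refine Eq.trans ?_ h
  rw [Quaternion.re_mul, Quaternion.re_mul]
  ring

theorem I_mul_K : (t.I : ℍ[ℝ]) * t.K = -(t.J : ℍ[ℝ]) := by
  rw [← t.mul_eq, ← mul_assoc, t.I_mul_I, neg_one_mul]

theorem K_mul_J : (t.K : ℍ[ℝ]) * t.J = -(t.I : ℍ[ℝ]) := by
  rw [← t.mul_eq, mul_assoc, t.J_mul_J, mul_neg_one]

theorem K_mul_I : (t.K : ℍ[ℝ]) * t.I = (t.J : ℍ[ℝ]) := by
  rw [← t.mul_eq, mul_assoc, t.J_mul_I, mul_neg, t.I_mul_K, neg_neg]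

theorem J_mul_K : (t.J : ℍ[ℝ]) * t.K = (t.I : ℍ[ℝ]) := by
  rw [← t.mul_eq, ← mul_assoc, t.J_mul_I, neg_mul, t.K_mul_J, neg_neg]

/-- The triple `J, K, I`. -/
def rotate : QuaternionTriple := ⟨t.J, t.K, t.I, t.J_mul_K⟩

theorem exists_eq_of_re_eq_zero {q : ℍ[ℝ]} (hq : q.re = 0) :
    ∃ a b c : ℝ, q = a • (t.I : ℍ[ℝ]) + b • (t.J : ℍ[ℝ]) + c • (t.K : ℍ[ℝ]) := by
  refine ⟨-(q * t.I).re, -(q * t.J).re, -(q * t.K).re, ?_⟩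
  -- The remainder `r` of the orthogonal projection is orthogonal to I, J and K, so it anticommutes
  -- with all three. But anticommuting with I and J makes it commute with K = IJ; hence rK = 0 and r
  -- = 0.
  set r : ℍ[ℝ] := q - (-(q * t.I).re • (t.I : ℍ[ℝ]) + -(q * t.J).re • (t.J : ℍ[ℝ]) +
    -(q * t.K).re • (t.K : ℍ[ℝ])) with hr
  have hr0 : r.re = 0 := by
    simp [hr, hq, t.I.re_eq_zero, t.J.re_eq_zero, t.K.re_eq_zero]
  have hI : (r * t.I).re = 0 := by
    simp only [hr, sub_mul, add_mul, smul_mul_assoc, t.I_mul_I, t.J_mul_I, t.K_mul_I,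
      Quaternion.re_sub, Quaternion.re_add, Quaternion.re_smul, Quaternion.re_neg,
      Quaternion.re_one, t.J.re_eq_zero, t.K.re_eq_zero]
    simp
  have hJ : (r * t.J).re = 0 := by
    simp only [hr, sub_mul, add_mul, smul_mul_assoc, t.mul_eq, t.J_mul_J, t.K_mul_J,
      Quaternion.re_sub, Quaternion.re_add, Quaternion.re_smul, Quaternion.re_neg,
      Quaternion.re_one, t.I.re_eq_zero, t.K.re_eq_zero]
    simp
  have hK : (r * t.K).re = 0 := by
    simp only [hr, sub_mul, add_mul, smul_mul_assoc, t.I_mul_K, t.J_mul_K, t.K_mul_K,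
      Quaternion.re_sub, Quaternion.re_add, Quaternion.re_smul, Quaternion.re_neg,
      Quaternion.re_one, t.I.re_eq_zero, t.J.re_eq_zero]
    simp
  have aI := anticommute_of_re_eq_zero hr0 t.I.re_eq_zero hI
  have aJ := anticommute_of_re_eq_zero hr0 t.J.re_eq_zero hJ
  have aK := anticommute_of_re_eq_zero hr0 t.K.re_eq_zero hK
  have cK : r * t.K = t.K * r := by
    rw [← t.mul_eq, ← mul_assoc, aI, neg_mul, mul_assoc, aJ, mul_neg, neg_neg, mul_assoc]
  have h0 : r * t.K = 0 := by
    have h2 : (2 : ℝ) • (r * t.K) = 0 := by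
      rw [two_smul]
      nth_rewrite 1 [aK]
      rw [cK, neg_add_cancel]
    exact (smul_eq_zero.mp h2).resolve_left two_ne_zero
  have h1 : r = 0 := by
    have h2 : r * t.K * t.K = 0 := by rw [h0, zero_mul]
    rwa [mul_assoc, t.K_mul_K, mul_neg_one, neg_eq_zero] at h2
  exact sub_eq_zero.mp h1

end QuaternionTriple

end Triple

/-! ### The action of the imaginary quaternions on 3-forms by derivations -/

section Derivation

theorem update_zero_vec {V : Type*} (a b c x : V) : Function.update ![a, b, c] 0 x = ![x, b, c] := by
  ext i; fin_cases i <;> rfl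

theorem update_one_vec {V : Type*} (a b c x : V) : Function.update ![a, b, c] 1 x = ![a, x, c] := by
  ext i; fin_cases i <;> rfl

theorem update_two_vec {V : Type*} (a b c x : V) : Function.update ![a, b, c] 2 x = ![a, b, x] := by
  ext i; fin_cases i <;> rfl

variable {V : Type*} [AddCommGroup V] [Module ℝ V] [TopologicalSpace V]

section Slots

variable (η : V [⋀^Fin 3]→L[ℝ] ℂ) (a b c x : V) (r : ℝ)

theorem map_add_left : η ![a + x, b, c] = η ![a, b, c] + η ![x, b, c] := by
  simpa only [update_zero_vec] using η.map_update_add ![a, b, c] 0 a x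

theorem map_add_middle : η ![a, b + x, c] = η ![a, b, c] + η ![a, x, c] := by
  simpa only [update_one_vec] using η.map_update_add ![a, b, c] 1 b x

theorem map_add_right : η ![a, b, c + x] = η ![a, b, c] + η ![a, b, x] := by
  simpa only [update_two_vec] using η.map_update_add ![a, b, c] 2 c x

theorem map_smul_left : η ![r • a, b, c] = r * η ![a, b, c] := by
  simpa only [update_zero_vec, Complex.real_smul] using η.map_update_smul ![a, b, c] 0 r a

theorem map_smul_middle : η ![a, r • b, c] = r * η ![a, b, c] := by
  simpa only [update_one_vec, Complex.real_smul] using η.map_update_smul ![a, b, c] 1 r b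

theorem map_smul_right : η ![a, b, r • c] = r * η ![a, b, c] := by
  simpa only [update_two_vec, Complex.real_smul] using η.map_update_smul ![a, b, c] 2 r c

theorem map_neg_left : η ![-a, b, c] = -η ![a, b, c] := by
  simpa using map_smul_left η a b c (-1)

theorem map_neg_middle : η ![a, -b, c] = -η ![a, b, c] := by
  simpa using map_smul_middle η a b c (-1)

theorem map_neg_right : η ![a, b, -c] = -η ![a, b, c] := by
  simpa using map_smul_right η a b c (-1)

theorem map_sub_left : η ![a - x, b, c] = η ![a, b, c] - η ![x, b, c] := by
  rw [sub_eq_add_neg, map_add_left, map_neg_left, sub_eq_add_neg]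

theorem map_sub_middle : η ![a, b - x, c] = η ![a, b, c] - η ![a, x, c] := by
  rw [sub_eq_add_neg, map_add_middle, map_neg_middle, sub_eq_add_neg]

theorem map_sub_right : η ![a, b, c - x] = η ![a, b, c] - η ![a, b, x] := by
  rw [sub_eq_add_neg, map_add_right, map_neg_right, sub_eq_add_neg]

end Slots

variable {η θ : V [⋀^Fin 3]→L[ℝ] ℂ}

theorem ext_three (h : ∀ a b c, η ![a, b, c] = θ ![a, b, c]) : η = θ := by
  ext v
  have hv : v = ![v 0, v 1, v 2] := by ext i; fin_cases i <;> rfl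
  rw [hv]
  exact h _ _ _

variable [IsTopologicalAddGroup V] [ContinuousConstSMul ℝ V]

/-- The pullback of 3-forms under the action of a quaternion. -/
def pullback (A : ℍ[ℝ] →ₐ[ℝ] (V →L[ℝ] V)) (q : ℍ[ℝ]) :
    (V [⋀^Fin 3]→L[ℝ] ℂ) →ₗ[ℂ] (V [⋀^Fin 3]→L[ℝ] ℂ) where
  toFun η := η.compContinuousLinearMap (A q)
  map_add' _ _ := rfl
  map_smul' _ _ := rfl

/-- The derivation of 3-forms given by the action of a quaternion. -/
def derivation (A : ℍ[ℝ] →ₐ[ℝ] (V →L[ℝ] V)) (q : ℍ[ℝ]) :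
    (V [⋀^Fin 3]→L[ℝ] ℂ) →ₗ[ℂ] (V [⋀^Fin 3]→L[ℝ] ℂ) :=
  (1 / 2 : ℂ) • (pullback A (1 + q) - pullback A (1 - q)) - pullback A q

variable (A : ℍ[ℝ] →ₐ[ℝ] (V →L[ℝ] V)) (p q : ℍ[ℝ]) (a b c : V)

theorem pullback_apply : pullback A q η ![a, b, c] = η ![A q a, A q b, A q c] := by
  change η (fun i => A q (![a, b, c] i)) = _
  congr 1
  ext i; fin_cases i <;> rfl

/-- The pullback under 1 + q is a cubic polynomial in q. Its odd part consists of the linear term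
and the pullback under q, so subtracting the latter leaves the linear term. This defines the
infinitesimal action by finitely many pullbacks, without differentiation. -/
theorem derivation_apply : derivation A q η ![a, b, c] =
    η ![A q a, b, c] + η ![a, A q b, c] + η ![a, b, A q c] := by
  have h : derivation A q η ![a, b, c] = (1 / 2 : ℂ) * (pullback A (1 + q) η ![a, b, c] -
    pullback A (1 - q) η ![a, b, c]) - pullback A q η ![a, b, c] := rfl
  rw [h]
  simp only [pullback_apply, map_add, map_sub, map_one, _root_.add_apply, _root_.sub_apply, one_apply_eq_self, map_add_left, map_add_middle, map_add_right, map_sub_left,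
    map_sub_middle, map_sub_right]
  ring

theorem derivation_add : derivation A (p + q) η = derivation A p η + derivation A q η := by
  refine ext_three fun a b c => ?_
  simp only [derivation_apply, map_add, _root_.add_apply, ContinuousAlternatingMap.add_apply, map_add_left, map_add_middle,
    map_add_right]
  ring

theorem derivation_smul (r : ℝ) : derivation A (r • q) η = (r : ℂ) • derivation A q η := by
  refine ext_three fun a b c => ?_
  simp only [derivation_apply, map_smul, _root_.smul_apply, ContinuousAlternatingMap.smul_apply, map_smul_left, map_smul_middle,
    map_smul_right, smul_eq_mul]
  ring

/-- Terms acting on different slots commute. In equal slots the order of p and q is reversed,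
because pullback is contravariant. -/
theorem derivation_comm : derivation A p (derivation A q η) =
    derivation A q (derivation A p η) + derivation A (q * p) η - derivation A (p * q) η := by
  refine ext_three fun a b c => ?_
  simp only [derivation_apply, map_mul, ContinuousAlternatingMap.add_apply, ContinuousAlternatingMap.sub_apply,
    mul_apply_eq_comp]
  ring

variable {A q}

theorem act_act_of_mul_self {n : ℝ} (hq : q * q = ((-n : ℝ) : ℍ[ℝ])) (v : V) :
    A q (A q v) = (-n) • v := by
  have h := congrArg (fun f => f v) (map_mul A q q)
  rw [hq, ← Quaternion.algebraMap_def, Algebra.algebraMap_eq_smul_one, map_smul, map_one] at h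
  exact h.symm

/-- The derivation is a sum of three commuting slot operators of square -1, so its eigenvalues are
among ±√-1 and ±3√-1. -/
theorem derivation_quartic (hq : q * q = -1) (η : V [⋀^Fin 3]→L[ℝ] ℂ) :
    derivation A q (derivation A q (derivation A q (derivation A q η))) =
      -((10 : ℂ) • derivation A q (derivation A q η)) - (9 : ℂ) • η := by
  have hA : ∀ v, A q (A q v) = -v := fun v => by
    rw [act_act_of_mul_self (n := 1) (by rw [hq]; simp) v, neg_one_smul]
  refine ext_three fun a b c => ?_
  simp only [derivation_apply, ContinuousAlternatingMap.sub_apply, ContinuousAlternatingMap.smul_apply,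
    ContinuousAlternatingMap.neg_apply, hA, map_neg_left, map_neg_middle, map_neg_right, smul_eq_mul]
  ring

/-- The pullback is the product of r + xᵢ over commuting slot operators xᵢ with xᵢ² = -n. Writing D
for their sum, the elementary symmetric functions are e₂ = (D² + 3n)/2 and e₃ = (D³ + 7nD)/6. So the
group action is polynomial in the infinitesimal one, and no exponential is needed. -/
theorem pullback_eq_derivation {n : ℝ} (hq : q * q = ((-n : ℝ) : ℍ[ℝ])) (r : ℝ)
    (η : V [⋀^Fin 3]→L[ℝ] ℂ) :
    pullback A (r + q) η = (r : ℂ) ^ 3 • η + (r : ℂ) ^ 2 • derivation A q η +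
      ((r : ℂ) / 2) • (derivation A q (derivation A q η) + (3 * n : ℂ) • η) +
      (1 / 6 : ℂ) • (derivation A q (derivation A q (derivation A q η)) +
        (7 * n : ℂ) • derivation A q η) := by
  have hA := act_act_of_mul_self (A := A) hq
  have hr : ∀ v, A (r + q) v = r • v + A q v := by
    intro v
    rw [map_add, ← Quaternion.algebraMap_def, Algebra.algebraMap_eq_smul_one, map_smul, map_one]
    rfl
  refine ext_three fun a b c => ?_
  simp only [pullback_apply, derivation_apply, ContinuousAlternatingMap.add_apply, ContinuousAlternatingMap.smul_apply, hA, hr,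
    map_add_left, map_add_middle, map_add_right, map_smul_left, map_smul_middle, map_smul_right,
    smul_eq_mul]
  push_cast
  ring

/-- The operators `H, E, F` of a standard triple on the 3-forms. -/
theorem slTwoOperators (A : ℍ[ℝ] →ₐ[ℝ] (V →L[ℝ] V)) (t : QuaternionTriple) :
    SlTwoOperators (-Complex.I • derivation A t.I)
      ((1 / 2 : ℂ) • (derivation A t.J + Complex.I • derivation A t.K))
      ((-1 / 2 : ℂ) • (derivation A t.J - Complex.I • derivation A t.K)) := by
  have neg : ∀ (q : ℍ[ℝ]) (η : V [⋀^Fin 3]→L[ℝ] ℂ), derivation A (-q) η = -derivation A q η := by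
    intro q η
    rw [← neg_one_smul ℝ q, derivation_smul]
    rw [Complex.ofReal_neg, Complex.ofReal_one]
    module
  have hIJ : ∀ η, derivation A t.I (derivation A t.J η) =
      derivation A t.J (derivation A t.I η) - (2 : ℂ) • derivation A t.K η := by
    intro η
    rw [derivation_comm, t.J_mul_I, t.mul_eq, neg]
    module
  have hIK : ∀ η, derivation A t.I (derivation A t.K η) =
      derivation A t.K (derivation A t.I η) + (2 : ℂ) • derivation A t.J η := by
    intro η
    rw [derivation_comm, t.K_mul_I, t.I_mul_K, neg]
    module
  have hJK : ∀ η, derivation A t.J (derivation A t.K η) =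
      derivation A t.K (derivation A t.J η) - (2 : ℂ) • derivation A t.I η := by
    intro η
    rw [derivation_comm, t.K_mul_J, t.J_mul_K, neg]
    module
  refine ⟨fun v => ?_, fun v => ?_, fun v => ?_, fun v => ?_⟩
  · simp only [LinearMap.smul_apply, LinearMap.add_apply, map_smul, map_add, hIJ, hIK]
    match_scalars <;> first | ring1 | (ring_nf; simp only [Complex.I_sq]; ring1)
  · simp only [LinearMap.smul_apply, LinearMap.sub_apply, map_smul, map_sub, hIJ, hIK]
    match_scalars <;> first | ring1 | (ring_nf; simp only [Complex.I_sq]; ring1)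
  · simp only [LinearMap.smul_apply, LinearMap.add_apply, LinearMap.sub_apply, map_smul, map_add,
      map_sub, hJK]
    match_scalars <;> ring1
  · simp only [LinearMap.smul_apply, map_smul, derivation_quartic t.I.sq_eq]
    match_scalars <;> first | ring1 | (ring_nf; simp only [Complex.I_sq, Complex.I_pow_four]; ring1)

theorem pullback_smul (r : ℝ) (q : ℍ[ℝ]) (η : V [⋀^Fin 3]→L[ℝ] ℂ) :
    pullback A (r • q) η = ((r : ℂ) ^ 3) • pullback A q η := by
  refine ext_three fun a b c => ?_
  simp only [pullback_apply, ContinuousAlternatingMap.smul_apply, map_smul, _root_.smul_apply,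
    map_smul_left, map_smul_middle, map_smul_right, smul_eq_mul]
  ring

theorem formRep_apply (A : ℍ[ℝ] →ₐ[ℝ] (V →L[ℝ] V)) (g : unitary ℍ[ℝ])
    (η : V [⋀^Fin 3]→L[ℝ] ℂ) :
    formRep A 3 g η = pullback A ((g⁻¹ : unitary ℍ[ℝ]) : ℍ[ℝ]) η := rfl

theorem pullback_mem_of_invariant {U : Submodule ℂ (V [⋀^Fin 3]→L[ℝ] ℂ)}
    (hU : ∀ g, ∀ v ∈ U, formRep A 3 g v ∈ U) (q : ℍ[ℝ]) {η : V [⋀^Fin 3]→L[ℝ] ℂ} (hη : η ∈ U) :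
    pullback A q η ∈ U := by
  by_cases hq : q = 0
  · have h0 := pullback_smul (A := A) 0 0 η
    rw [zero_smul, Complex.ofReal_zero, zero_pow three_ne_zero] at h0
    have h1 : pullback A 0 η = 0 := h0.trans (by module)
    rw [hq, h1]
    exact U.zero_mem
  have hn : ‖q‖ ≠ 0 := norm_ne_zero_iff.mpr hq
  set u : ℍ[ℝ] := ‖q‖⁻¹ • q with hu
  have hu1 : Quaternion.normSq u = 1 := by
    rw [Quaternion.normSq_eq_norm_mul_self, hu, norm_smul, norm_inv, norm_norm,
      inv_mul_cancel₀ hn, one_mul]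
  have hmem : u ∈ unitary ℍ[ℝ] := by
    rw [Unitary.mem_iff, Quaternion.star_mul_self, Quaternion.self_mul_star, hu1]
    exact ⟨rfl, rfl⟩
  have hqu : q = ‖q‖ • u := by rw [hu, smul_smul, mul_inv_cancel₀ hn, one_smul]
  rw [hqu, pullback_smul]
  refine U.smul_mem _ ?_
  have h1 := hU (⟨u, hmem⟩⁻¹) η hη
  rwa [formRep_apply, inv_inv] at h1

theorem derivation_mem_of_invariant {U : Submodule ℂ (V [⋀^Fin 3]→L[ℝ] ℂ)}
    (hU : ∀ g, ∀ v ∈ U, formRep A 3 g v ∈ U) (q : ℍ[ℝ]) {η : V [⋀^Fin 3]→L[ℝ] ℂ} (hη : η ∈ U) :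
    derivation A q η ∈ U :=
  U.sub_mem (U.smul_mem _ (U.sub_mem (pullback_mem_of_invariant hU _ hη)
    (pullback_mem_of_invariant hU _ hη))) (pullback_mem_of_invariant hU _ hη)

/-- A subspace of the 3-forms is invariant under the unit quaternions if and only if it is
invariant under the operators `H, E, F` of a standard triple. -/
theorem invariant_iff_isStable (A : ℍ[ℝ] →ₐ[ℝ] (V →L[ℝ] V)) (t : QuaternionTriple)
    (U : Submodule ℂ (V [⋀^Fin 3]→L[ℝ] ℂ)) :
    (∀ g, ∀ v ∈ U, formRep A 3 g v ∈ U) ↔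
      IsStable (-Complex.I • derivation A t.I)
        ((1 / 2 : ℂ) • (derivation A t.J + Complex.I • derivation A t.K))
        ((-1 / 2 : ℂ) • (derivation A t.J - Complex.I • derivation A t.K)) U := by
  constructor
  · intro hU
    have h := fun q {η} hη => derivation_mem_of_invariant hU q (η := η) hη
    exact ⟨fun hv => U.smul_mem _ (h _ hv),
      fun hv => U.smul_mem _ (U.add_mem (h _ hv) (U.smul_mem _ (h _ hv))),
      fun hv => U.smul_mem _ (U.sub_mem (h _ hv) (U.smul_mem _ (h _ hv)))⟩
  · intro hU g v hv
    have hI : ∀ {v}, v ∈ U → derivation A t.I v ∈ U := fun {v} hv => by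
      have h1 := U.smul_mem Complex.I (hU.H_mem hv)
      rwa [LinearMap.smul_apply, smul_smul, mul_neg, Complex.I_mul_I, neg_neg, one_smul] at h1
    have hJ : ∀ {v}, v ∈ U → derivation A t.J v ∈ U := fun {v} hv => by
      have h1 := U.sub_mem (hU.E_mem hv) (hU.F_mem hv)
      convert h1 using 1
      simp only [LinearMap.smul_apply, LinearMap.add_apply, LinearMap.sub_apply]
      module
    have hK : ∀ {v}, v ∈ U → derivation A t.K v ∈ U := fun {v} hv => by
      have h1 := U.smul_mem (-Complex.I) (U.add_mem (hU.E_mem hv) (hU.F_mem hv))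
      convert h1 using 1
      simp only [LinearMap.smul_apply, LinearMap.add_apply, LinearMap.sub_apply]
      match_scalars <;> first | ring1 | (ring_nf; simp only [Complex.I_sq]; ring1)
    have hD : ∀ q : ℍ[ℝ], q.re = 0 → ∀ {v}, v ∈ U → derivation A q v ∈ U := by
      intro q hq v hv
      obtain ⟨a, b, c, rfl⟩ := t.exists_eq_of_re_eq_zero hq
      simp only [derivation_add, derivation_smul]
      exact U.add_mem (U.add_mem (U.smul_mem _ (hI hv)) (U.smul_mem _ (hJ hv)))
        (U.smul_mem _ (hK hv))
    rw [formRep_apply]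
    set p : ℍ[ℝ] := ((g⁻¹ : unitary ℍ[ℝ]) : ℍ[ℝ])
    have hp : p = ((p.re : ℝ) : ℍ[ℝ]) + p.im := (Quaternion.re_add_im p).symm
    have him : p.im.re = 0 := Quaternion.re_im p
    have hd := fun {v} => hD p.im him (v := v)
    -- The pullback is now a polynomial in the derivation of `p.im`, a real combination of those of
    -- I, J, K.
    rw [hp, pullback_eq_derivation (mul_self_of_re_eq_zero him)]
    exact U.add_mem (U.add_mem (U.add_mem (U.smul_mem _ hv) (U.smul_mem _ (hd hv)))
      (U.smul_mem _ (U.add_mem (hd (hd hv)) (U.smul_mem _ hv))))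
      (U.smul_mem _ (U.add_mem (hd (hd (hd hv))) (U.smul_mem _ (hd hv))))

theorem plusProj_eq_zero_iff_casimir (A : ℍ[ℝ] →ₐ[ℝ] (V →L[ℝ] V)) (t : QuaternionTriple)
    (η : V [⋀^Fin 3]→L[ℝ] ℂ) :
    plusProj A 3 η = 0 ↔ η ∈ casimirSpace (-Complex.I • derivation A t.I)
        ((1 / 2 : ℂ) • (derivation A t.J + Complex.I • derivation A t.K))
        ((-1 / 2 : ℂ) • (derivation A t.J - Complex.I • derivation A t.K)) 3 := by
  have hs := slTwoOperators A t
  have hst := invariant_iff_isStable A t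
  have h1 := hs.weightSubspace_three hst
  have h2 := hs.iSup_weightSubspace_lt_three hst
  have hc : IsCompl (plusSubspace A 3) (lowSubspace A 3) := by
    rw [plusSubspace, lowSubspace, h1, h2]
    exact hs.isCompl_casimirSpace
  -- Complementarity excludes the default value 0 of `plusProj`, so its kernel is exactly the low
  -- subspace.
  rw [plusProj, dif_pos hc, Submodule.projection_apply_eq_zero_iff, ← h2]
  rfl

theorem casimir_eq (A : ℍ[ℝ] →ₐ[ℝ] (V →L[ℝ] V)) (t : QuaternionTriple)
    (η : V [⋀^Fin 3]→L[ℝ] ℂ) :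
    casimir (-Complex.I • derivation A t.I)
        ((1 / 2 : ℂ) • (derivation A t.J + Complex.I • derivation A t.K))
        ((-1 / 2 : ℂ) • (derivation A t.J - Complex.I • derivation A t.K)) η =
      -(derivation A t.I (derivation A t.I η) + derivation A t.J (derivation A t.J η) +
        derivation A t.K (derivation A t.K η)) := by
  simp only [casimir, LinearMap.smul_apply, LinearMap.add_apply, LinearMap.sub_apply,
    LinearMap.comp_apply, map_smul, map_add, map_sub]
  match_scalars <;> first | ring1 | (ring_nf; simp)

/-- The forms without component of maximal weight. -/
theorem plusProj_eq_zero_iff (A : ℍ[ℝ] →ₐ[ℝ] (V →L[ℝ] V)) (t : QuaternionTriple)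
    (η : V [⋀^Fin 3]→L[ℝ] ℂ) :
    plusProj A 3 η = 0 ↔ ∀ a b c,
      (η ![A t.I a, A t.I b, c] + η ![A t.I a, b, A t.I c] + η ![a, A t.I b, A t.I c]) +
      (η ![A t.J a, A t.J b, c] + η ![A t.J a, b, A t.J c] + η ![a, A t.J b, A t.J c]) +
      (η ![A t.K a, A t.K b, c] + η ![A t.K a, b, A t.K c] + η ![a, A t.K b, A t.K c]) =
      3 * η ![a, b, c] := by
  have hA : ∀ (L : ImaginaryUnit) v, A L (A L v) = -v := fun L v => by
    rw [act_act_of_mul_self (n := 1) (by rw [L.sq_eq]; simp) v, neg_one_smul]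
  -- In the square of a sum of three slot operators each mixed product occurs twice, and the three
  -- squares contribute -1 each. Casimir eigenvalue 3 then becomes: the nine mixed terms add up to
  -- 3η.
  have key : ∀ (L : ImaginaryUnit) a b c, derivation A L (derivation A L η) ![a, b, c] =
      2 * (η ![A L a, A L b, c] + η ![A L a, b, A L c] + η ![a, A L b, A L c]) -
        3 * η ![a, b, c] := by
    intro L a b c
    simp only [derivation_apply, hA, map_neg_left, map_neg_middle, map_neg_right]
    ring
  rw [plusProj_eq_zero_iff_casimir A t, SlTwoOperators.mem_casimirSpace, casimir_eq]
  constructor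
  · intro h a b c
    have h1 := congrArg (fun θ : V [⋀^Fin 3]→L[ℝ] ℂ => θ ![a, b, c]) h
    simp only [ContinuousAlternatingMap.neg_apply, ContinuousAlternatingMap.add_apply,
      ContinuousAlternatingMap.smul_apply, smul_eq_mul, key] at h1
    linear_combination (-1 / 2 : ℂ) * h1
  · intro h
    refine ext_three fun a b c => ?_
    simp only [ContinuousAlternatingMap.neg_apply, ContinuousAlternatingMap.add_apply,
      ContinuousAlternatingMap.smul_apply, smul_eq_mul, key]
    linear_combination (-2 : ℂ) * h a b c

end Derivation

/-! ### Tensors with values in the quaternionic Hermitian forms -/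

section Tensor

variable {V : Type*} [AddCommGroup V] [Module ℝ V]

/-- Three endomorphisms satisfying the relations of the quaternions. -/
structure QuaternionRelations (I J K : V →ₗ[ℝ] V) : Prop where
  II (v : V) : I (I v) = -v
  JJ (v : V) : J (J v) = -v
  KK (v : V) : K (K v) = -v
  IJ (v : V) : I (J v) = K v
  JK (v : V) : J (K v) = I v
  KI (v : V) : K (I v) = J v
  JI (v : V) : J (I v) = -K v
  KJ (v : V) : K (J v) = -I v
  IK (v : V) : I (K v) = -J v

theorem QuaternionRelations.rotate {I J K : V →ₗ[ℝ] V} (h : QuaternionRelations I J K) :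
    QuaternionRelations J K I :=
  ⟨h.JJ, h.KK, h.II, h.JK, h.KI, h.IJ, h.KJ, h.IK, h.JI⟩

/-- A linear map `u ↦ g u` to the symmetric bilinear forms for which `I, J, K` are skew. -/
structure IsHermitianTensor (g : V →ₗ[ℝ] V →ₗ[ℝ] V →ₗ[ℝ] ℝ) (I J K : V →ₗ[ℝ] V) : Prop where
  symm (u v w : V) : g u v w = g u w v
  skewI (u v w : V) : g u (I v) w = -g u v (I w)
  skewJ (u v w : V) : g u (J v) w = -g u v (J w)
  skewK (u v w : V) : g u (K v) w = -g u v (K w)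

/-- The cyclic sum of `g a b (L c)`. -/
def cyclicForm (g : V →ₗ[ℝ] V →ₗ[ℝ] V →ₗ[ℝ] ℝ) (L : V →ₗ[ℝ] V) (a b c : V) : ℝ :=
  g a b (L c) + g b c (L a) + g c a (L b)

/-- The cyclic sum of `g a b (J c) + g (I a) b (K c)`. -/
def obstruction (g : V →ₗ[ℝ] V →ₗ[ℝ] V →ₗ[ℝ] ℝ) (I J K : V →ₗ[ℝ] V) (a b c : V) : ℝ :=
  (g a b (J c) + g b c (J a) + g c a (J b)) +
    (g (I a) b (K c) + g (I b) c (K a) + g (I c) a (K b))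

/-- The condition that the 3-form `η` has no component of maximal weight. -/
def IsLow (η : V → V → V → ℝ) (I J K : V →ₗ[ℝ] V) : Prop :=
  ∀ a b c, (η (I a) (I b) c + η (I a) b (I c) + η a (I b) (I c)) +
    (η (J a) (J b) c + η (J a) b (J c) + η a (J b) (J c)) +
    (η (K a) (K b) c + η (K a) b (K c) + η a (K b) (K c)) = 3 * η a b c

variable {g : V →ₗ[ℝ] V →ₗ[ℝ] V →ₗ[ℝ] ℝ} {I J K : V →ₗ[ℝ] V}

theorem IsHermitianTensor.rotate (h : IsHermitianTensor g I J K) : IsHermitianTensor g J K I :=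
  ⟨h.symm, h.skewJ, h.skewK, h.skewI⟩

theorem obstruction_left_I (hq : QuaternionRelations I J K) (hg : IsHermitianTensor g I J K)
    (a b c : V) : obstruction g I J K (I a) b c =
      (g (I a) b (J c) + g (I b) c (J a) + g (I c) a (J b)) -
        (g a b (K c) + g b c (K a) + g c a (K b)) := by
  simp only [obstruction, hq.II, hq.JI, hq.KI, map_neg, LinearMap.neg_apply, hg.skewI, hq.IJ, hq.IK]
  ring

/-- Write S(X,Y) for the cyclic sum of g (X a) b (Y c). All identities are normalised by moving
endomorphisms from the second slot of g to the third. -/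
theorem cyclic_JK_eq (hq : QuaternionRelations I J K) (hg : IsHermitianTensor g I J K)
    (h : ∀ a b c, obstruction g I J K a b c = 0) (a b c : V) :
    g (J a) b (K c) + g (J b) c (K a) + g (J c) a (K b) =
      g a b (I c) + g b c (I a) + g c a (I b) := by
  -- `h1` reads S(K,J) + S(J,K) = 0. In the sum of `h2`, `h3`, `h4` the terms g (I a) b c cancel,
  -- leaving S(J,K) - S(K,J) = 2 S(1,I). Adding the two gives S(J,K) = S(1,I).
  have h1 := h (K a) (J b) (J c)
  have h2 := h (K a) (I b) (I c)
  have h3 := h (I a) (K b) (I c)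
  have h4 := h (I a) (I b) (K c)
  simp only [obstruction, hq.II, hq.JI, hq.KI, hq.IJ, hq.JJ, hq.KJ, hq.IK, hq.JK, hq.KK, map_neg,
    LinearMap.neg_apply, hg.skewI, hg.skewJ, hg.skewK] at h1 h2 h3 h4 ⊢
  linarith

/-- With first argument J a, the rotated obstruction is the difference of the two sides of
`cyclic_JK_eq`; and J is surjective. -/
theorem obstruction_rotate (hq : QuaternionRelations I J K) (hg : IsHermitianTensor g I J K)
    (h : ∀ a b c, obstruction g I J K a b c = 0) (a b c : V) :
    obstruction g J K I a b c = 0 := by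
  have h1 : ∀ a, obstruction g J K I (J a) b c = 0 := fun a => by
    rw [obstruction_left_I hq.rotate hg.rotate, cyclic_JK_eq hq hg h, sub_self]
  have h2 := h1 (J (-a))
  rwa [hq.JJ, neg_neg] at h2

/-- For η the cyclic sum of g a b (I c), the I-terms of the low condition give η, and the J- and
K-terms give 2 S(J,K) - η and -2 S(K,J) - η. The condition is therefore S(J,K) - S(K,J) = 2η, the
sum of the three instances below. -/
theorem isLow_of_obstruction (hq : QuaternionRelations I J K) (hg : IsHermitianTensor g I J K)
    (h : ∀ a b c, obstruction g I J K a b c = 0) : IsLow (cyclicForm g I) I J K := by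
  intro a b c
  have h1 := h (K a) (I b) (I c)
  have h2 := h (I a) (K b) (I c)
  have h3 := h (I a) (I b) (K c)
  simp only [cyclicForm, obstruction, hq.II, hq.JI, hq.KI, hq.IJ, hq.KJ, hq.IK, hq.JK,
    hq.KK, map_neg, LinearMap.neg_apply, hg.skewI, hg.skewJ, hg.skewK] at h1 h2 h3 ⊢
  linarith

/-- The low condition at (a, b, K c) minus the one at (I a, I b, K c) is a nonzero multiple of the
obstruction at (a, b, c). -/
theorem obstruction_of_isLow (hq : QuaternionRelations I J K) (hg : IsHermitianTensor g I J K)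
    (h : IsLow (cyclicForm g I) I J K) (a b c : V) : obstruction g I J K a b c = 0 := by
  have h1 := h a b (K c)
  have h2 := h (I a) (I b) (K c)
  have h3 := h (I a) b (J c)
  have h4 := h a (I b) (J c)
  simp only [cyclicForm, obstruction, hq.II, hq.JI, hq.KI, hq.IJ, hq.JJ, hq.KJ, hq.IK, hq.JK,
    hq.KK, map_neg, LinearMap.neg_apply, hg.skewI, hg.skewJ, hg.skewK] at h1 h2 h3 h4 ⊢
  linarith

end Tensor

/-! ### The two first order conditions at a point -/

section Pointwise

variable {V : Type*} [AddCommGroup V] [Module ℝ V] [TopologicalSpace V]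

/-- For type (3,0) all slots are holomorphic, so the only set S is everything, and the sum over T
expands the product of (1 - √-1 L)/2 over the slots. -/
theorem hodgePart_three (L : V →L[ℝ] V) (η : V [⋀^Fin 3]→L[ℝ] ℂ) (a b c : V) :
    hodgePart L 3 η ![a, b, c] = (1 / 8 : ℂ) * (η ![a, b, c] -
      (η ![L a, L b, c] + η ![L a, b, L c] + η ![a, L b, L c]) -
      Complex.I * (η ![L a, b, c] + η ![a, L b, c] + η ![a, b, L c] - η ![L a, L b, L c])) := by
  have h : hodgePart L 3 η ![a, b, c] =
      (∑ S ∈ Finset.powersetCard 3 (Finset.univ : Finset (Fin 3)), ∑ T : Finset (Fin 3),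
        hodgeTerm L η S T) ![a, b, c] := rfl
  have hS : Finset.powersetCard 3 (Finset.univ : Finset (Fin 3)) = {Finset.univ} := by decide
  have hT : (Finset.univ : Finset (Finset (Fin 3))) =
      {∅, {0}, {1}, {2}, {0, 1}, {0, 2}, {1, 2}, {0, 1, 2}} := by decide
  have hv : ∀ T : Finset (Fin 3), (fun j => if j ∈ T then L (![a, b, c] j) else ![a, b, c] j) =
      ![if 0 ∈ T then L a else a, if 1 ∈ T then L b else b, if 2 ∈ T then L c else c] := by
    intro T; ext j; fin_cases j <;> rfl
  rw [h, hS, Finset.sum_singleton, hT]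
  simp only [_root_.sum_apply, hodgeTerm_apply, hv, Fin.prod_univ_three, Finset.mem_univ, if_true]
  rw [Finset.sum_insert (by decide), Finset.sum_insert (by decide), Finset.sum_insert (by decide),
    Finset.sum_insert (by decide), Finset.sum_insert (by decide), Finset.sum_insert (by decide),
    Finset.sum_insert (by decide), Finset.sum_singleton]
  simp
  ring_nf

variable [IsTopologicalAddGroup V] [ContinuousConstSMul ℝ V]

theorem quaternionRelations (A : ℍ[ℝ] →ₐ[ℝ] (V →L[ℝ] V)) (t : QuaternionTriple) :
    QuaternionRelations (A t.I : V →ₗ[ℝ] V) (A t.J) (A t.K) := by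
  have h : ∀ (p q r : ℍ[ℝ]), p * q = r → ∀ v, A p (A q v) = A r v := by
    rintro p q _ rfl v
    rw [map_mul]
    rfl
  have h' : ∀ (p q r : ℍ[ℝ]), p * q = -r → ∀ v, A p (A q v) = -A r v := by
    intro p q r hr v
    rw [h p q _ hr, map_neg]
    rfl
  have h1 : ∀ (p q : ℍ[ℝ]), p * q = -1 → ∀ v, A p (A q v) = -v := by
    intro p q hr v
    rw [h' p q _ hr, map_one]
    rfl
  exact ⟨h1 _ _ t.I_mul_I, h1 _ _ t.J_mul_J, h1 _ _ t.K_mul_K, h _ _ _ t.mul_eq,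
    h _ _ _ t.J_mul_K, h _ _ _ t.K_mul_I, h' _ _ _ t.J_mul_I, h' _ _ _ t.K_mul_J,
    h' _ _ _ t.I_mul_K⟩

variable {A : ℍ[ℝ] →ₐ[ℝ] (V →L[ℝ] V)} {g : V →ₗ[ℝ] V →ₗ[ℝ] V →ₗ[ℝ] ℝ}
  {θ : ImaginaryUnit → V [⋀^Fin 3]→L[ℝ] ℂ}

theorem plusProj_eq_zero_iff_isLow (t : QuaternionTriple) (L : ImaginaryUnit)
    (hθ : ∀ L a b c, θ L ![a, b, c] = (cyclicForm g (A (L : ℍ[ℝ]) : V →ₗ[ℝ] V) a b c : ℝ)) :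
    plusProj A 3 (θ L) = 0 ↔
      IsLow (cyclicForm g (A (L : ℍ[ℝ]) : V →ₗ[ℝ] V)) (A t.I : V →ₗ[ℝ] V) (A t.J) (A t.K) := by
  rw [plusProj_eq_zero_iff A t]
  simp only [hθ, IsLow]
  exact forall₃_congr fun a b c => by norm_cast

theorem hodgePart_eq_zero_iff_obstruction (t : QuaternionTriple)
    (hg : IsHermitianTensor g (A t.I : V →ₗ[ℝ] V) (A t.J) (A t.K))
    (hθ : ∀ L a b c, θ L ![a, b, c] = (cyclicForm g (A (L : ℍ[ℝ]) : V →ₗ[ℝ] V) a b c : ℝ)) :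
    hodgePart (A t.I) 3 ((1 / 2 : ℂ) • (θ t.J + Complex.I • θ t.K)) = 0 ↔
      ∀ a b c, obstruction g (A t.I : V →ₗ[ℝ] V) (A t.J) (A t.K) a b c = 0 := by
  have hq := quaternionRelations A t
  set I : V →ₗ[ℝ] V := (A t.I).toLinearMap with hI
  set J : V →ₗ[ℝ] V := (A t.J).toLinearMap with hJ
  set K : V →ₗ[ℝ] V := (A t.K).toLinearMap with hK
  -- A (3,0)-form is determined by its real part: its imaginary part is minus the real part with I
  -- inserted in one slot.
  have key : ∀ a b c, hodgePart (A t.I) 3 ((1 / 2 : ℂ) • (θ t.J + Complex.I • θ t.K)) ![a, b, c] =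
      (1 / 4 : ℂ) * ((obstruction g I J K a b c : ℝ) -
        Complex.I * (obstruction g I J K (I a) b c : ℝ)) := by
    intro a b c
    rw [hodgePart_three]
    simp only [ContinuousAlternatingMap.add_apply, ContinuousAlternatingMap.smul_apply, hθ,
      smul_eq_mul, ← hJ, ← hK]
    have hAI : ∀ x, A t.I x = I x := fun _ => rfl
    simp only [hAI, cyclicForm, obstruction, hq.II, hq.JI, hq.KI, hq.IJ, hq.IK, map_neg,
      LinearMap.neg_apply, hg.skewI]
    apply Complex.ext <;> simp <;> ring
  constructor
  · intro h a b c
    have h1 := key a b c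
    rw [h] at h1
    have h2 := congrArg Complex.re h1
    simpa using h2.symm
  · intro h
    refine ext_three fun a b c => ?_
    rw [key, h, h]
    simp

theorem plusProj_eq_zero_iff_obstruction (t : QuaternionTriple)
    (hg : IsHermitianTensor g (A t.I : V →ₗ[ℝ] V) (A t.J) (A t.K))
    (hθ : ∀ L a b c, θ L ![a, b, c] = (cyclicForm g (A (L : ℍ[ℝ]) : V →ₗ[ℝ] V) a b c : ℝ)) :
    plusProj A 3 (θ t.I) = 0 ↔
      ∀ a b c, obstruction g (A t.I : V →ₗ[ℝ] V) (A t.J) (A t.K) a b c = 0 := by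
  rw [plusProj_eq_zero_iff_isLow t t.I hθ]
  exact ⟨obstruction_of_isLow (quaternionRelations A t) hg,
    isLow_of_obstruction (quaternionRelations A t) hg⟩

theorem plusProj_eq_zero_of_obstruction (t : QuaternionTriple)
    (hg : IsHermitianTensor g (A t.I : V →ₗ[ℝ] V) (A t.J) (A t.K))
    (hθ : ∀ L a b c, θ L ![a, b, c] = (cyclicForm g (A (L : ℍ[ℝ]) : V →ₗ[ℝ] V) a b c : ℝ))
    (h : ∀ a b c, obstruction g (A t.I : V →ₗ[ℝ] V) (A t.J) (A t.K) a b c = 0)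
    (L : ImaginaryUnit) : plusProj A 3 (θ L) = 0 := by
  have hq := quaternionRelations A t
  have h2 := obstruction_rotate hq hg h
  have h3 := obstruction_rotate hq.rotate hg.rotate h2
  have pI := (plusProj_eq_zero_iff_obstruction t hg hθ).mpr h
  have pJ := (plusProj_eq_zero_iff_obstruction t.rotate hg.rotate hθ).mpr h2
  have pK := (plusProj_eq_zero_iff_obstruction t.rotate.rotate hg.rotate.rotate hθ).mpr h3
  obtain ⟨r, s, u, hL⟩ := t.exists_eq_of_re_eq_zero L.re_eq_zero
  have hlin : θ L = (r : ℂ) • θ t.I + (s : ℂ) • θ t.J + (u : ℂ) • θ t.K := by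
    refine ext_three fun a b c => ?_
    have hA : ∀ v, A (L : ℍ[ℝ]) v = r • A t.I v + s • A t.J v + u • A t.K v := by
      intro v
      rw [hL, map_add, map_add, map_smul, map_smul, map_smul]
      rfl
    simp only [ContinuousAlternatingMap.add_apply, ContinuousAlternatingMap.smul_apply, hθ,
      cyclicForm, ContinuousLinearMap.coe_coe, hA, map_add, map_smul, smul_eq_mul]
    push_cast
    ring
  have pJ' : plusProj A 3 (θ t.J) = 0 := pJ
  have pK' : plusProj A 3 (θ t.K) = 0 := pK
  rw [hlin, map_add, map_add, map_smul, map_smul, map_smul, pI, pJ', pK']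
  module

end Pointwise

/-! ### The Obata connection at a point -/

section Obata

variable {V : Type*} [AddCommGroup V] [Module ℝ V]

/-- The first derivatives `a, b` of two anticommuting integrable complex structures `I, J`. -/
structure IntegrablePair (I J K : V →ₗ[ℝ] V) (a b : V →ₗ[ℝ] V →ₗ[ℝ] V) : Prop where
  skew_a (u v : V) : a u (I v) = -I (a u v)
  skew_b (u v : V) : b u (J v) = -J (b u v)
  mixed (u v : V) : a (J u) v + b (I u) v - a (J v) u - b (I v) u =
    I (b u v) - I (b v u) + (J (a u v) - J (a v u))

/-- The connection form of the Obata connection. -/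
def obataForm (I J K : V →ₗ[ℝ] V) (a b : V →ₗ[ℝ] V →ₗ[ℝ] V) : V →ₗ[ℝ] V →ₗ[ℝ] V :=
  LinearMap.mk₂ ℝ
    (fun u v => (1 / 2 : ℝ) • (-I (a v u) - J (b u v) + K (b (I u) v) - K (a (J v) u)))
    (fun u u' v => by simp only [map_add, LinearMap.add_apply]; module)
    (fun r u v => by simp only [map_smul, LinearMap.smul_apply]; module)
    (fun u v v' => by simp only [map_add, LinearMap.add_apply]; module)
    (fun r u v => by simp only [map_smul, LinearMap.smul_apply]; module)

variable {I J K : V →ₗ[ℝ] V} {a b : V →ₗ[ℝ] V →ₗ[ℝ] V}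

theorem obataForm_apply (u v : V) : obataForm I J K a b u v =
    (1 / 2 : ℝ) • (-I (a v u) - J (b u v) + K (b (I u) v) - K (a (J v) u)) := rfl

/-- Vanishing torsion is K applied to the mixed integrability condition. -/
theorem obataForm_symm (hq : QuaternionRelations I J K) (h : IntegrablePair I J K a b) (u v : V) :
    obataForm I J K a b u v = obataForm I J K a b v u := by
  have h1 := congrArg K (h.mixed u v)
  simp only [map_add, map_sub, hq.KI, hq.KJ] at h1
  rw [obataForm_apply, obataForm_apply]
  linear_combination (norm := module) (1 / 2 : ℝ) • h1

theorem obataForm_J (hq : QuaternionRelations I J K) (h : IntegrablePair I J K a b) (u v : V) :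
    b u v = J (obataForm I J K a b u v) - obataForm I J K a b u (J v) := by
  simp only [obataForm_apply, h.skew_b, hq.JJ, map_smul, map_add, map_sub, map_neg,
    LinearMap.neg_apply, hq.JI, hq.JK, hq.KJ]
  module

/-- The formula for the connection form gives ∇J = 0 directly; ∇I = 0 becomes equally direct after
exchanging the two arguments by symmetry. -/
theorem obataForm_I (hq : QuaternionRelations I J K) (h : IntegrablePair I J K a b) (u v : V) :
    a u v = I (obataForm I J K a b u v) - obataForm I J K a b u (I v) := by
  rw [obataForm_symm hq h u v, obataForm_symm hq h u (I v)]
  simp only [obataForm_apply, h.skew_a, hq.II, map_smul, map_add, map_sub, map_neg,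
    LinearMap.neg_apply, hq.IJ, hq.IK, hq.KI]
  module

end Obata

/-! ### First order jets at a point: the Obata connection and the covariant derivative of the metric
-/

section FirstOrder

variable {E : Type*} [NormedAddCommGroup E] [NormedSpace ℝ E]

/-- The first order data at a point of a hypercomplex structure `A` with derivative `a`, and of a
quaternionic Hermitian metric `h` with derivative `k`. -/
structure FirstOrderData (A : ℍ[ℝ] →ₐ[ℝ] (E →L[ℝ] E)) (a : ℍ[ℝ] →ₗ[ℝ] E →L[ℝ] E →L[ℝ] E)
    (h : E →L[ℝ] E →L[ℝ] ℝ) (k : E →L[ℝ] E →L[ℝ] E →L[ℝ] ℝ) : Prop where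
  deriv_mul (p q : ℍ[ℝ]) (u v : E) : a (p * q) u v = a p u (A q v) + A p (a q u v)
  nijenhuis (L : ImaginaryUnit) (u v : E) :
    a L (A L u) v - a L (A L v) u + A L (a L v u) - A L (a L u v) = 0
  metric_symm (u v : E) : h u v = h v u
  metric_skew (L : ImaginaryUnit) (u v : E) : h (A L u) v = -h u (A L v)
  deriv_symm (u v w : E) : k u v w = k u w v
  deriv_skew (L : ImaginaryUnit) (u v w : E) :
    k u (A L v) w + h (a L u v) w = -(k u v (A L w) + h v (a L u w))

variable {A : ℍ[ℝ] →ₐ[ℝ] (E →L[ℝ] E)} {a : ℍ[ℝ] →ₗ[ℝ] E →L[ℝ] E →L[ℝ] E}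
  {h : E →L[ℝ] E →L[ℝ] ℝ} {k : E →L[ℝ] E →L[ℝ] E →L[ℝ] ℝ}

namespace FirstOrderData

/-- The bilinear map underlying a continuous bilinear map. -/
def bilin (f : E →L[ℝ] E →L[ℝ] E) : E →ₗ[ℝ] E →ₗ[ℝ] E :=
  LinearMap.mk₂ ℝ (fun u v => f u v) (by simp) (by simp) (by simp) (by simp)

theorem integrablePair (d : FirstOrderData A a h k) (t : QuaternionTriple) :
    IntegrablePair (A t.I : E →ₗ[ℝ] E) (A t.J) (A t.K) (bilin (a t.I)) (bilin (a t.J)) := by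
  have h1 : ∀ u v, a 1 u v = 0 := by
    intro u v
    have := d.deriv_mul 1 1 u v
    simpa using this
  have sk : ∀ (L : ImaginaryUnit) u v, a L u (A L v) = -A L (a L u v) := by
    intro L u v
    have := d.deriv_mul L L u v
    rw [L.sq_eq, map_neg, _root_.neg_apply, _root_.neg_apply, h1, neg_zero] at this
    exact eq_neg_of_add_eq_zero_left this.symm
  refine ⟨sk t.I, sk t.J, fun u v => ?_⟩
  change a t.I (A t.J u) v + a t.J (A t.I u) v - a t.I (A t.J v) u - a t.J (A t.I v) u =
    A t.I (a t.J u v) - A t.I (a t.J v u) + (A t.J (a t.I u v) - A t.J (a t.I v u))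
  set r : ℝ := (Real.sqrt 2)⁻¹ with hr
  have hr2 : r * r = 1 / 2 := by
    rw [hr, ← mul_inv, Real.mul_self_sqrt (by norm_num)]; norm_num
  -- Polarisation: (I + J)/√2 is again an imaginary unit. Its Nijenhuis tensor is quadratic in the
  -- structure, so twice it minus those of I and J is the mixed condition.
  let L : ImaginaryUnit := ⟨r • ((t.I : ℍ[ℝ]) + t.J), by
    rw [smul_mul_smul_comm, hr2, add_mul, mul_add, mul_add, t.I_mul_I, t.J_mul_J, t.mul_eq,
      t.J_mul_I]
    module⟩
  have hN := d.nijenhuis L u v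
  have hL : (L : ℍ[ℝ]) = r • ((t.I : ℍ[ℝ]) + t.J) := rfl
  rw [hL] at hN
  simp only [map_smul, map_add, _root_.smul_apply, _root_.add_apply, smul_add, smul_smul, hr2]
    at hN
  have hI := d.nijenhuis t.I u v
  have hJ := d.nijenhuis t.J u v
  linear_combination (norm := module) (2 : ℝ) • hN - hI - hJ

/-- A symmetric connection form for which the hypercomplex structure is parallel. -/
theorem exists_connection (d : FirstOrderData A a h k) :
    ∃ Γ : E →ₗ[ℝ] E →ₗ[ℝ] E, (∀ u v, Γ u v = Γ v u) ∧
      ∀ (L : ImaginaryUnit) u v, a L u v = A L (Γ u v) - Γ u (A L v) := by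
  let t := stdTriple
  have hp := d.integrablePair t
  have hq := quaternionRelations A t
  refine ⟨obataForm (A t.I : E →ₗ[ℝ] E) (A t.J) (A t.K) (bilin (a t.I)) (bilin (a t.J)),
    obataForm_symm hq hp, fun L u v => ?_⟩
  have hI : ∀ u v, a t.I u v = _ := obataForm_I hq hp
  have hJ : ∀ u v, a t.J u v = _ := obataForm_J hq hp
  set Γ := obataForm (A t.I : E →ₗ[ℝ] E) (A t.J) (A t.K) (bilin (a t.I)) (bilin (a t.J))
  have hIJ : ∀ v, A t.I (A t.J v) = A t.K v := hq.IJ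
  have hK : ∀ u v, a t.K u v = A t.K (Γ u v) - Γ u (A t.K v) := by
    intro u v
    rw [← t.mul_eq, d.deriv_mul, hI, hJ, t.mul_eq]
    simp only [ContinuousLinearMap.coe_coe, map_sub, hIJ]
    abel
  obtain ⟨x, y, z, hL⟩ := t.exists_eq_of_re_eq_zero L.re_eq_zero
  rw [hL]
  simp only [map_add, map_smul, _root_.add_apply, _root_.smul_apply, hI, hJ, hK,
    ContinuousLinearMap.coe_coe]
  module

set_option synthInstance.maxHeartbeats 200000 in
theorem exists_tensor (d : FirstOrderData A a h k) :
    ∃ g : E →ₗ[ℝ] E →ₗ[ℝ] E →ₗ[ℝ] ℝ,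
      (∀ t : QuaternionTriple, IsHermitianTensor g (A t.I : E →ₗ[ℝ] E) (A t.J) (A t.K)) ∧
      ∀ (L : ImaginaryUnit) u v w,
        (k u v (A L w) + h v (a L u w)) - (k v u (A L w) + h u (a L v w)) +
          (k w u (A L v) + h u (a L w v)) = cyclicForm g (A (L : ℍ[ℝ]) : E →ₗ[ℝ] E) u v w := by
  obtain ⟨Γ, hsymm, hΓ⟩ := d.exists_connection
  -- The tensor ∇h for ∇ = ∂ + Γ. Since L is parallel, L stays skew for it; in the alternating sum
  -- for dω_L the terms with Γ cancel by its symmetry.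
  let g : E →ₗ[ℝ] E →ₗ[ℝ] E →ₗ[ℝ] ℝ := LinearMap.mk₂ ℝ
    (fun u v => (k u v : E →ₗ[ℝ] ℝ) - (h (Γ u v) : E →ₗ[ℝ] ℝ) - (h v : E →ₗ[ℝ] ℝ) ∘ₗ Γ u)
    (fun u u' v => by ext w; simp; ring) (fun r u v => by ext w; simp; ring)
    (fun u v v' => by ext w; simp; ring) (fun r u v => by ext w; simp; ring)
  have hg : ∀ u v w, g u v w = k u v w - h (Γ u v) w - h v (Γ u w) := fun _ _ _ => rfl
  have skew : ∀ (L : ImaginaryUnit) u v w, g u (A L v) w = -g u v (A L w) := by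
    intro L u v w
    have h1 := d.deriv_skew L u v w
    simp only [hΓ, map_sub, _root_.sub_apply, d.metric_skew] at h1
    simp only [hg, d.metric_skew]
    linarith
  refine ⟨g, fun t => ⟨fun u v w => ?_, skew t.I, skew t.J, skew t.K⟩, fun L u v w => ?_⟩
  · rw [hg, hg, d.deriv_symm u v w, d.metric_symm (Γ u v), d.metric_symm v]
    ring
  · have h1 := d.deriv_skew L v u w
    rw [d.deriv_symm v (A L u) w, d.metric_symm (a L v u) w] at h1
    simp only [hΓ, map_sub] at h1
    simp only [cyclicForm, hg, hΓ, map_sub, ContinuousLinearMap.coe_coe]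
    have e1 := d.metric_skew L (Γ u v) w
    have e2 := d.metric_skew L (Γ u w) v
    have e3 := d.metric_skew L (Γ v w) u
    rw [d.metric_symm (A L (Γ u v)) w] at e1
    rw [d.metric_symm (A L (Γ u w)) v] at e2
    rw [d.metric_symm (A L (Γ v w)) u] at e3
    rw [hsymm v u] at *
    rw [hsymm w u] at *
    rw [hsymm w v] at *
    linarith

end FirstOrderData

end FirstOrder

/-! ### A hypercomplex Hermitian structure in a chart -/

section Chart

open scoped Topology

variable {E : Type*} [NormedAddCommGroup E] [NormedSpace ℝ E]
  {M : Type*} [TopologicalSpace M] [ChartedSpace E M]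

variable (E) in
/-- The derivative of the inverse of the preferred chart around `x`. -/
def frame (x : M) (y : E) : E →L[ℝ] TangentSpace 𝓘(ℝ, E) ((extChartAt 𝓘(ℝ, E) x).symm y) :=
  mfderiv 𝓘(ℝ, E) 𝓘(ℝ, E) (extChartAt 𝓘(ℝ, E) x).symm y

variable (E) in
/-- The derivative of the preferred chart around `x`. -/
def coframe (x : M) (y : E) : TangentSpace 𝓘(ℝ, E) ((extChartAt 𝓘(ℝ, E) x).symm y) →L[ℝ] E :=
  mfderiv 𝓘(ℝ, E) 𝓘(ℝ, E) (extChartAt 𝓘(ℝ, E) x) ((extChartAt 𝓘(ℝ, E) x).symm y)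

theorem symm_mem_source {x : M} {y : E} (hy : y ∈ (extChartAt 𝓘(ℝ, E) x).target) :
    (extChartAt 𝓘(ℝ, E) x).symm y ∈ (chartAt E x).source := by
  rw [← extChartAt_source 𝓘(ℝ, E)]
  exact (extChartAt 𝓘(ℝ, E) x).map_target hy

variable [IsManifold 𝓘(ℝ, E) ∞ M] {x : M} {y : E}

theorem coframe_frame (hy : y ∈ (extChartAt 𝓘(ℝ, E) x).target) (v : E) :
    coframe E x y (frame E x y v) = v := by
  have : IsManifold 𝓘(ℝ, E) 1 M := IsManifold.of_le (n := ∞) (by norm_num)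
  have h := mfderiv_extChartAt_comp_mfderivWithin_extChartAt_symm (I := 𝓘(ℝ, E)) hy
  rw [ModelWithCorners.range_eq_univ, mfderivWithin_univ] at h
  exact congrArg (fun f => f v) h

theorem frame_coframe (hy : y ∈ (extChartAt 𝓘(ℝ, E) x).target)
    (v : TangentSpace 𝓘(ℝ, E) ((extChartAt 𝓘(ℝ, E) x).symm y)) :
    frame E x y (coframe E x y v) = v := by
  have : IsManifold 𝓘(ℝ, E) 1 M := IsManifold.of_le (n := ∞) (by norm_num)
  have h := mfderivWithin_extChartAt_symm_comp_mfderiv_extChartAt (I := 𝓘(ℝ, E)) hy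
  rw [ModelWithCorners.range_eq_univ, mfderivWithin_univ] at h
  exact congrArg (fun f => f v) h

theorem symmL_eq_frame (hy : y ∈ (extChartAt 𝓘(ℝ, E) x).target) :
    (trivializationAt E (TangentSpace 𝓘(ℝ, E)) x).symmL ℝ ((extChartAt 𝓘(ℝ, E) x).symm y) =
      frame E x y := by
  have : IsManifold 𝓘(ℝ, E) 1 M := IsManifold.of_le (n := ∞) (by norm_num)
  rw [TangentBundle.symmL_trivializationAt (symm_mem_source hy), ModelWithCorners.range_eq_univ,
    mfderivWithin_univ, (extChartAt 𝓘(ℝ, E) x).right_inv hy]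
  rfl

theorem continuousLinearMapAt_eq_coframe (hy : y ∈ (extChartAt 𝓘(ℝ, E) x).target) :
    (trivializationAt E (TangentSpace 𝓘(ℝ, E)) x).continuousLinearMapAt ℝ
      ((extChartAt 𝓘(ℝ, E) x).symm y) = coframe E x y := by
  have : IsManifold 𝓘(ℝ, E) 1 M := IsManifold.of_le (n := ∞) (by norm_num)
  rw [TangentBundle.continuousLinearMapAt_trivializationAt (symm_mem_source hy)]
  rfl

/-- An endomorphism field of the tangent bundle in the preferred chart around `x`. -/
def chartEnd (B : (x : M) → TangentSpace 𝓘(ℝ, E) x →L[ℝ] TangentSpace 𝓘(ℝ, E) x) (x : M) (y : E) :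
    E →L[ℝ] E :=
  ContinuousLinearMap.inCoordinates E (TangentSpace 𝓘(ℝ, E)) E (TangentSpace 𝓘(ℝ, E)) x
    ((extChartAt 𝓘(ℝ, E) x).symm y) x ((extChartAt 𝓘(ℝ, E) x).symm y)
    (B ((extChartAt 𝓘(ℝ, E) x).symm y))

theorem chartEnd_apply (B : (x : M) → TangentSpace 𝓘(ℝ, E) x →L[ℝ] TangentSpace 𝓘(ℝ, E) x)
    (hy : y ∈ (extChartAt 𝓘(ℝ, E) x).target) (v : E) :
    chartEnd B x y v = coframe E x y (B _ (frame E x y v)) := by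
  rw [← symmL_eq_frame hy, ← continuousLinearMapAt_eq_coframe hy]
  rfl

theorem frame_chartEnd (B : (x : M) → TangentSpace 𝓘(ℝ, E) x →L[ℝ] TangentSpace 𝓘(ℝ, E) x)
    (hy : y ∈ (extChartAt 𝓘(ℝ, E) x).target) (v : E) :
    frame E x y (chartEnd B x y v) = B _ (frame E x y v) := by
  rw [chartEnd_apply B hy, frame_coframe hy]

/-- A bilinear form on the tangent bundle in the preferred chart around `x`. -/
def chartBilin (B : (x : M) → TangentSpace 𝓘(ℝ, E) x →L[ℝ] TangentSpace 𝓘(ℝ, E) x →L[ℝ] ℝ)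
    (x : M) (y : E) : E →L[ℝ] E →L[ℝ] ℝ :=
  ContinuousLinearMap.inCoordinates E (TangentSpace 𝓘(ℝ, E)) (E →L[ℝ] ℝ)
    (fun x : M => TangentSpace 𝓘(ℝ, E) x →L[ℝ] ℝ) x
    ((extChartAt 𝓘(ℝ, E) x).symm y) x ((extChartAt 𝓘(ℝ, E) x).symm y)
    (B ((extChartAt 𝓘(ℝ, E) x).symm y))

theorem chartBilin_apply
    (B : (x : M) → TangentSpace 𝓘(ℝ, E) x →L[ℝ] TangentSpace 𝓘(ℝ, E) x →L[ℝ] ℝ)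
    (hy : y ∈ (extChartAt 𝓘(ℝ, E) x).target) (u v : E) :
    chartBilin B x y u v = B _ (frame E x y u) (frame E x y v) := by
  have h := symm_mem_source hy
  rw [chartBilin, inCoordinates_apply_eq₂ (E₃ := fun _ : M => ℝ) h h (Set.mem_univ _),
    ← symmL_eq_frame hy, Trivialization.symmL_apply _ h, Trivialization.symmL_apply _ h]
  simp

theorem differentiableAt_comp_symm {F : Type*} [NormedAddCommGroup F] [NormedSpace ℝ F]
    {f : M → F} (hf : ContMDiffAt 𝓘(ℝ, E) 𝓘(ℝ, F) ∞ f x) :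
    DifferentiableAt ℝ (fun y => f ((extChartAt 𝓘(ℝ, E) x).symm y)) (extChartAt 𝓘(ℝ, E) x x) := by
  have h1 : ContMDiffAt 𝓘(ℝ, E) 𝓘(ℝ, E) ∞ (extChartAt 𝓘(ℝ, E) x).symm
      (extChartAt 𝓘(ℝ, E) x x) :=
    (contMDiffOn_extChartAt_symm x).contMDiffAt (extChartAt_target_mem_nhds x)
  have h2 : ContMDiffAt 𝓘(ℝ, E) 𝓘(ℝ, F) ∞ f
      ((extChartAt 𝓘(ℝ, E) x).symm (extChartAt 𝓘(ℝ, E) x x)) := by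
    rwa [extChartAt_to_inv]
  exact (contMDiffAt_iff_contDiffAt.mp (h2.comp _ h1)).differentiableAt (by simp)

theorem differentiableAt_chartEnd
    {B : (x : M) → TangentSpace 𝓘(ℝ, E) x →L[ℝ] TangentSpace 𝓘(ℝ, E) x}
    (hB : ContMDiffAt 𝓘(ℝ, E) (𝓘(ℝ, E).prod 𝓘(ℝ, E →L[ℝ] E)) ∞
      (fun x => TotalSpace.mk' (E →L[ℝ] E)
        (E := fun x : M => TangentSpace 𝓘(ℝ, E) x →L[ℝ] TangentSpace 𝓘(ℝ, E) x) x (B x)) x) :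
    DifferentiableAt ℝ (chartEnd B x) (extChartAt 𝓘(ℝ, E) x x) :=
  differentiableAt_comp_symm ((contMDiffAt_hom_bundle _).mp hB).2

set_option synthInstance.maxHeartbeats 200000 in
theorem differentiableAt_chartBilin
    {B : (x : M) → TangentSpace 𝓘(ℝ, E) x →L[ℝ] TangentSpace 𝓘(ℝ, E) x →L[ℝ] ℝ}
    (hB : ContMDiffAt 𝓘(ℝ, E) (𝓘(ℝ, E).prod 𝓘(ℝ, E →L[ℝ] E →L[ℝ] ℝ)) ∞
      (fun x => TotalSpace.mk' (E →L[ℝ] E →L[ℝ] ℝ)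
        (E := fun x : M => TangentSpace 𝓘(ℝ, E) x →L[ℝ] TangentSpace 𝓘(ℝ, E) x →L[ℝ] ℝ)
        x (B x)) x) :
    DifferentiableAt ℝ (chartBilin B x) (extChartAt 𝓘(ℝ, E) x x) :=
  differentiableAt_comp_symm ((contMDiffAt_hom_bundle _).mp hB).2

/-- At its centre the preferred chart has the identity as derivative, so linear algebra on the
tangent space and on the model space agree there. -/
theorem chartEnd_self (B : (x : M) → TangentSpace 𝓘(ℝ, E) x →L[ℝ] TangentSpace 𝓘(ℝ, E) x) :
    chartEnd B x (extChartAt 𝓘(ℝ, E) x x) = B x := by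
  have : IsManifold 𝓘(ℝ, E) 1 M := IsManifold.of_le (n := ∞) (by norm_num)
  have h1 : chartEnd B x (extChartAt 𝓘(ℝ, E) x x) =
      ContinuousLinearMap.inCoordinates E (TangentSpace 𝓘(ℝ, E)) E (TangentSpace 𝓘(ℝ, E))
        x x x x (B x) :=
    congrArg (fun m => ContinuousLinearMap.inCoordinates E (TangentSpace 𝓘(ℝ, E)) E
      (TangentSpace 𝓘(ℝ, E)) x m x m (B m)) (extChartAt_to_inv (I := 𝓘(ℝ, E)) x)
  rw [h1, ContinuousLinearMap.inCoordinates,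
    TangentBundle.continuousLinearMapAt_trivializationAt (mem_chart_source E x),
    TangentBundle.symmL_trivializationAt (mem_chart_source E x), mfderiv_extChartAt_self,
    mfderivWithin_range_extChartAt_symm]
  rfl

end Chart

/-! ### Lie brackets and the Nijenhuis tensor in a chart -/

section ChartCalculus

open scoped Topology

variable {E : Type*} [NormedAddCommGroup E] [NormedSpace ℝ E]
  {M : Type*} [TopologicalSpace M] [ChartedSpace E M] [IsManifold 𝓘(ℝ, E) ∞ M] {x : M} {y : E}

theorem mfderiv_symm_inverse_apply (hy : y ∈ (extChartAt 𝓘(ℝ, E) x).target)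
    (v : TangentSpace 𝓘(ℝ, E) ((extChartAt 𝓘(ℝ, E) x).symm y)) :
    (frame E x y).inverse v = coframe E x y v := by
  rw [ContinuousLinearMap.inverse_eq (g := coframe E x y)]
  · ext w; exact frame_coframe hy w
  · ext w; exact coframe_frame hy w

/-- The Lie bracket of two vector fields, computed in the preferred chart. -/
theorem mlieBracket_eq_of_chart {V W : (x : M) → TangentSpace 𝓘(ℝ, E) x} {V' W' : E → E}
    (hV : ∀ y ∈ (extChartAt 𝓘(ℝ, E) x).target, V _ = frame E x y (V' y))
    (hW : ∀ y ∈ (extChartAt 𝓘(ℝ, E) x).target, W _ = frame E x y (W' y)) :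
    VectorField.mlieBracket 𝓘(ℝ, E) V W x =
      (fderiv ℝ W' (extChartAt 𝓘(ℝ, E) x x) (V' (extChartAt 𝓘(ℝ, E) x x)) -
        fderiv ℝ V' (extChartAt 𝓘(ℝ, E) x x) (W' (extChartAt 𝓘(ℝ, E) x x)) : E) := by
  have : IsManifold 𝓘(ℝ, E) 1 M := IsManifold.of_le (n := ∞) (by norm_num)
  have key : ∀ {V : (x : M) → TangentSpace 𝓘(ℝ, E) x} {V' : E → E},
      (∀ y ∈ (extChartAt 𝓘(ℝ, E) x).target, V _ = frame E x y (V' y)) →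
      VectorField.mpullbackWithin 𝓘(ℝ, E) 𝓘(ℝ, E) (extChartAt 𝓘(ℝ, E) x).symm V
        (Set.range 𝓘(ℝ, E)) =ᶠ[𝓝 (extChartAt 𝓘(ℝ, E) x x)] V' := by
    intro V V' hV
    filter_upwards [extChartAt_target_mem_nhds (I := 𝓘(ℝ, E)) x] with y hy
    rw [VectorField.mpullbackWithin_apply, hV y hy, ModelWithCorners.range_eq_univ,
      mfderivWithin_univ]
    exact (mfderiv_symm_inverse_apply hy _).trans (coframe_frame hy _)
  have h1 := key hV
  have h2 := key hW
  rw [← VectorField.mlieBracketWithin_univ, VectorField.mlieBracketWithin_apply,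
    mfderiv_extChartAt_self, Set.preimage_univ, Set.univ_inter]
  rw [ModelWithCorners.range_eq_univ] at h1 h2 ⊢
  have hid : (ContinuousLinearMap.id ℝ E).inverse = ContinuousLinearMap.id ℝ E :=
    ContinuousLinearMap.inverse_id
  refine (congrArg (fun f : E →L[ℝ] E => f _) hid).trans ?_
  refine Eq.trans ?_ (h1.lieBracket_vectorField_eq h2)
  exact congrFun VectorField.lieBracketWithin_univ _

theorem contMDiffAt_constant_field (u : E) :
    ContMDiffAt 𝓘(ℝ, E) 𝓘(ℝ, E).tangent ∞ (fun m : M => (⟨m,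
      (trivializationAt E (TangentSpace 𝓘(ℝ, E)) x).symm m u⟩ : TangentBundle 𝓘(ℝ, E) M)) x := by
  rw [contMDiffAt_section]
  refine (contMDiffAt_const (c := u)).congr_of_eventuallyEq ?_
  filter_upwards [(trivializationAt E (TangentSpace 𝓘(ℝ, E)) x).open_baseSet.mem_nhds
    (FiberBundle.mem_baseSet_trivializationAt' x)] with m hm
  exact (trivializationAt E (TangentSpace 𝓘(ℝ, E)) x).apply_mk_symm hm u ▸ rfl

/-- On coordinate-constant fields U, V the brackets are [U, V] = 0, [LU, V] = -(∂_v L)u, [U, LV] =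
(∂_u L)v, so only first derivatives of L remain. -/
theorem nijenhuis_constant_fields (B : (x : M) → TangentSpace 𝓘(ℝ, E) x →L[ℝ] TangentSpace 𝓘(ℝ, E) x)
    (hB : DifferentiableAt ℝ (chartEnd B x) (extChartAt 𝓘(ℝ, E) x x)) (hi : IsIntegrable B)
    (u v : E) (a : E →L[ℝ] E →L[ℝ] E) (ha : a = fderiv ℝ (chartEnd B x) (extChartAt 𝓘(ℝ, E) x x))
    (L : E →L[ℝ] E) (hL : L = B x) :
    a (L u) v - a (L v) u + L (a v u) - L (a u v) = 0 := by
  have hconst : ∀ u : E, ∀ y ∈ (extChartAt 𝓘(ℝ, E) x).target,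
      (trivializationAt E (TangentSpace 𝓘(ℝ, E)) x).symm ((extChartAt 𝓘(ℝ, E) x).symm y) u =
        frame E x y u := by
    intro u y hy
    rw [← symmL_eq_frame hy]
    exact (Trivialization.symmL_apply _ (symm_mem_source hy) u).symm
  have hfield : ∀ u : E, ∀ y ∈ (extChartAt 𝓘(ℝ, E) x).target,
      B ((extChartAt 𝓘(ℝ, E) x).symm y) ((trivializationAt E (TangentSpace 𝓘(ℝ, E)) x).symm
        ((extChartAt 𝓘(ℝ, E) x).symm y) u) = frame E x y (chartEnd B x y u) := by
    intro u y hy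
    rw [hconst u y hy, frame_chartEnd B hy]
  have h := hi x _ _ (contMDiffAt_constant_field u) (contMDiffAt_constant_field v)
  have hd : ∀ u w : E, fderiv ℝ (fun y => chartEnd B x y u) (extChartAt 𝓘(ℝ, E) x x) w = a w u := by
    intro u w
    rw [ha, (hB.hasFDerivAt.clm_apply (hasFDerivAt_const u _)).fderiv]
    simp
  have h0 : ∀ u, chartEnd B x (extChartAt 𝓘(ℝ, E) x x) u = L u := by
    intro u
    rw [chartEnd_self, hL]
  rw [nijenhuis, mlieBracket_eq_of_chart (hfield u) (hfield v),
    mlieBracket_eq_of_chart (hfield u) (hconst v), mlieBracket_eq_of_chart (hconst u) (hfield v),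
    mlieBracket_eq_of_chart (hconst u) (hconst v)] at h
  simp only [hd, h0, fderiv_fun_const, ← hL] at h
  have h' : a (L u) v - a (L v) u - L (0 - a v u) - L (a u v - 0) - (0 - 0) = 0 := h
  rw [zero_sub, sub_zero, sub_zero, sub_zero, map_neg, sub_neg_eq_add] at h'
  exact h'

end ChartCalculus

/-! ### The hypercomplex structure and the metric in a chart -/

section HermitianChart

open scoped Topology

variable {E : Type*} [NormedAddCommGroup E] [NormedSpace ℝ E]
  {M : Type*} [TopologicalSpace M] [ChartedSpace E M] [IsManifold 𝓘(ℝ, E) ∞ M]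

/-- The action of a quaternion in the preferred chart around `x`. -/
def HypercomplexStructure.chartAct (Q : HypercomplexStructure E M) (x : M) (q : ℍ[ℝ]) :
    E → E →L[ℝ] E := chartEnd (fun x => Q.act x q) x

/-- The metric in the preferred chart around `x`. -/
def QuaternionicHermitianMetric.chartMetric {Q : HypercomplexStructure E M}
    (h : QuaternionicHermitianMetric Q) (x : M) : E → E →L[ℝ] E →L[ℝ] ℝ :=
  chartBilin (fun x => h.inner x) x

namespace HypercomplexStructure

variable (Q : HypercomplexStructure E M) (x : M) {y : E}

theorem differentiableAt_chartAct (q : ℍ[ℝ]) :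
    DifferentiableAt ℝ (Q.chartAct x q) (extChartAt 𝓘(ℝ, E) x x) :=
  differentiableAt_chartEnd (Q.contMDiff_act q x)

variable {x} in
theorem chartAct_apply (hy : y ∈ (extChartAt 𝓘(ℝ, E) x).target) (q : ℍ[ℝ]) (v : E) :
    Q.chartAct x q y v = coframe E x y (Q.act _ q (frame E x y v)) := chartEnd_apply _ hy v

variable {x} in
theorem frame_chartAct (hy : y ∈ (extChartAt 𝓘(ℝ, E) x).target) (q : ℍ[ℝ]) (v : E) :
    frame E x y (Q.chartAct x q y v) = Q.act _ q (frame E x y v) := frame_chartEnd _ hy v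

theorem chartAct_add (p q : ℍ[ℝ]) :
    Q.chartAct x (p + q) =ᶠ[𝓝 (extChartAt 𝓘(ℝ, E) x x)] Q.chartAct x p + Q.chartAct x q := by
  filter_upwards [extChartAt_target_mem_nhds (I := 𝓘(ℝ, E)) x] with y hy
  ext v
  simp only [Pi.add_apply, _root_.add_apply, chartAct_apply Q hy, map_add]

theorem chartAct_smul (r : ℝ) (q : ℍ[ℝ]) :
    Q.chartAct x (r • q) =ᶠ[𝓝 (extChartAt 𝓘(ℝ, E) x x)] r • Q.chartAct x q := by
  filter_upwards [extChartAt_target_mem_nhds (I := 𝓘(ℝ, E)) x] with y hy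
  ext v
  simp only [Pi.smul_apply, _root_.smul_apply, chartAct_apply Q hy, map_smul]

theorem chartAct_mul (p q : ℍ[ℝ]) :
    Q.chartAct x (p * q) =ᶠ[𝓝 (extChartAt 𝓘(ℝ, E) x x)]
      fun y => (Q.chartAct x p y).comp (Q.chartAct x q y) := by
  filter_upwards [extChartAt_target_mem_nhds (I := 𝓘(ℝ, E)) x] with y hy
  ext v
  rw [ContinuousLinearMap.comp_apply, chartAct_apply Q hy, chartAct_apply Q hy p,
    frame_chartAct Q hy, map_mul]
  rfl

/-- The derivative of the action of the quaternions in the preferred chart. -/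
def derivAct : ℍ[ℝ] →ₗ[ℝ] E →L[ℝ] E →L[ℝ] E where
  toFun q := fderiv ℝ (Q.chartAct x q) (extChartAt 𝓘(ℝ, E) x x)
  map_add' p q := by
    rw [(Q.chartAct_add x p q).fderiv_eq]
    exact fderiv_add (Q.differentiableAt_chartAct x p) (Q.differentiableAt_chartAct x q)
  map_smul' r q := by
    rw [(Q.chartAct_smul x r q).fderiv_eq]
    exact fderiv_const_smul (Q.differentiableAt_chartAct x q) r

/-- The action of the quaternions on the model space at the centre of the preferred chart. -/
def centreAct : ℍ[ℝ] →ₐ[ℝ] (E →L[ℝ] E) := Q.act x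

theorem chartAct_self (q : ℍ[ℝ]) :
    Q.chartAct x q (extChartAt 𝓘(ℝ, E) x x) = Q.centreAct x q :=
  chartEnd_self (fun x => Q.act x q)

theorem hasFDerivAt_chartAct (q : ℍ[ℝ]) :
    HasFDerivAt (Q.chartAct x q) (Q.derivAct x q) (extChartAt 𝓘(ℝ, E) x x) :=
  (Q.differentiableAt_chartAct x q).hasFDerivAt

end HypercomplexStructure

namespace QuaternionicHermitianMetric

variable {Q : HypercomplexStructure E M} (h : QuaternionicHermitianMetric Q) (x : M) {y : E}

theorem inner_act_left (L : ImaginaryUnit) (u v : TangentSpace 𝓘(ℝ, E) x) :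
    h.inner x (Q.act x L u) v = -h.inner x u (Q.act x L v) := by
  have h1 := h.invariant x ⟨L, L.mem_unitary⟩ u (Q.act x L v)
  have h2 : Q.act x (L : ℍ[ℝ]) (Q.act x (L : ℍ[ℝ]) v) = -v := by
    have := congrArg (fun f => f v) (map_mul (Q.act x) (L : ℍ[ℝ]) (L : ℍ[ℝ]))
    rw [L.sq_eq] at this
    simpa using this.symm
  simp only [h2, map_neg] at h1
  linarith

set_option synthInstance.maxHeartbeats 200000 in
theorem differentiableAt_chartMetric :
    DifferentiableAt ℝ (h.chartMetric x) (extChartAt 𝓘(ℝ, E) x x) :=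
  differentiableAt_chartBilin (h.contMDiff x)

variable {x} in
theorem chartMetric_apply (hy : y ∈ (extChartAt 𝓘(ℝ, E) x).target) (u v : E) :
    h.chartMetric x y u v = h.inner _ (frame E x y u) (frame E x y v) := chartBilin_apply _ hy u v

variable {x} in
theorem chartMetric_symm (hy : y ∈ (extChartAt 𝓘(ℝ, E) x).target) (u v : E) :
    h.chartMetric x y u v = h.chartMetric x y v u := by
  rw [h.chartMetric_apply hy, h.chartMetric_apply hy, h.symm]

variable {x} in
theorem chartMetric_skew (hy : y ∈ (extChartAt 𝓘(ℝ, E) x).target) (L : ImaginaryUnit) (u v : E) :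
    h.chartMetric x y (Q.chartAct x L y u) v = -h.chartMetric x y u (Q.chartAct x L y v) := by
  rw [h.chartMetric_apply hy, h.chartMetric_apply hy, Q.frame_chartAct hy, Q.frame_chartAct hy,
    h.inner_act_left]

set_option synthInstance.maxHeartbeats 200000 in
/-- The derivative of the metric in the preferred chart. -/
def derivMetric : E →L[ℝ] E →L[ℝ] E →L[ℝ] ℝ :=
  fderiv ℝ (h.chartMetric x) (extChartAt 𝓘(ℝ, E) x x)

set_option synthInstance.maxHeartbeats 200000 in
theorem hasFDerivAt_chartMetric_apply {f f' : E → E} {a b : E →L[ℝ] E}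
    (hf : HasFDerivAt f a (extChartAt 𝓘(ℝ, E) x x))
    (hf' : HasFDerivAt f' b (extChartAt 𝓘(ℝ, E) x x)) (u : E) :
    DifferentiableAt ℝ (fun y => h.chartMetric x y (f y) (f' y)) (extChartAt 𝓘(ℝ, E) x x) ∧
    fderiv ℝ (fun y => h.chartMetric x y (f y) (f' y)) (extChartAt 𝓘(ℝ, E) x x) u =
      h.derivMetric x u (f (extChartAt 𝓘(ℝ, E) x x)) (f' (extChartAt 𝓘(ℝ, E) x x)) +
      h.chartMetric x (extChartAt 𝓘(ℝ, E) x x) (a u) (f' (extChartAt 𝓘(ℝ, E) x x)) +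
      h.chartMetric x (extChartAt 𝓘(ℝ, E) x x) (f (extChartAt 𝓘(ℝ, E) x x)) (b u) := by
  have h1 := ((h.differentiableAt_chartMetric x).hasFDerivAt.clm_apply hf).clm_apply hf'
  refine ⟨h1.differentiableAt, ?_⟩
  rw [h1.fderiv]
  simp [derivMetric]
  ring

theorem hasFDerivAt_act_apply (L : ImaginaryUnit) (v : E) :
    HasFDerivAt (fun y => Q.chartAct x L y v) ((Q.derivAct x L).flip v)
      (extChartAt 𝓘(ℝ, E) x x) := by
  have h1 := (Q.hasFDerivAt_chartAct x L).clm_apply (hasFDerivAt_const v _)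
  convert h1 using 1
  ext w
  simp

set_option synthInstance.maxHeartbeats 200000 in
theorem firstOrderData : FirstOrderData (Q.centreAct x) (Q.derivAct x)
    (h.chartMetric x (extChartAt 𝓘(ℝ, E) x x)) (h.derivMetric x) where
  deriv_mul p q u v := by
    have h1 : Q.derivAct x (p * q) = fderiv ℝ (fun y => (Q.chartAct x p y).comp (Q.chartAct x q y))
      (extChartAt 𝓘(ℝ, E) x x) := (Q.chartAct_mul x p q).fderiv_eq
    rw [h1, ((Q.hasFDerivAt_chartAct x p).clm_comp (Q.hasFDerivAt_chartAct x q)).fderiv]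
    rw [Q.chartAct_self, Q.chartAct_self]
    simp [add_comm]
  nijenhuis L u v := nijenhuis_constant_fields (fun x => Q.act x L)
    (Q.differentiableAt_chartAct x L) (Q.integrable L) u v _ rfl _ rfl
  metric_symm u v := h.chartMetric_symm (mem_extChartAt_target x) u v
  metric_skew L u v := by
    have h1 := h.chartMetric_skew (mem_extChartAt_target x) L u v
    rwa [Q.chartAct_self] at h1
  deriv_symm u v w := by
    have h1 := fun v w => (h.hasFDerivAt_chartMetric_apply x
      (hasFDerivAt_const v (extChartAt 𝓘(ℝ, E) x x)) (hasFDerivAt_const w _) u).2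
    have h2 : (fun y => h.chartMetric x y v w) =ᶠ[𝓝 (extChartAt 𝓘(ℝ, E) x x)]
        fun y => h.chartMetric x y w v := by
      filter_upwards [extChartAt_target_mem_nhds (I := 𝓘(ℝ, E)) x] with y hy
      exact h.chartMetric_symm hy v w
    have h3 := h1 v w
    rw [h2.fderiv_eq, h1 w v] at h3
    simpa using h3.symm
  deriv_skew L u v w := by
    have h1 := (h.hasFDerivAt_chartMetric_apply x (hasFDerivAt_act_apply (Q := Q) x L v)
      (hasFDerivAt_const w _) u).2
    have h1' := (h.hasFDerivAt_chartMetric_apply x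
      (hasFDerivAt_const v _) (hasFDerivAt_act_apply (Q := Q) x L w) u).2
    have h2 : (fun y => h.chartMetric x y (Q.chartAct x L y v) w)
        =ᶠ[𝓝 (extChartAt 𝓘(ℝ, E) x x)]
        fun y => -h.chartMetric x y v (Q.chartAct x L y w) := by
      filter_upwards [extChartAt_target_mem_nhds (I := 𝓘(ℝ, E)) x] with y hy
      exact h.chartMetric_skew hy L v w
    rw [h2.fderiv_eq, fderiv_fun_neg, _root_.neg_apply, h1'] at h1
    simp only [Q.chartAct_self] at h1
    simpa using h1.symm

end QuaternionicHermitianMetric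

end HermitianChart

/-! ### The exterior derivatives of the forms ω and Ω, and the comparison of the two conditions -/

section ExteriorDerivative

open scoped Topology

variable {E : Type*} [NormedAddCommGroup E] [NormedSpace ℝ E]

variable (E) in
set_option synthInstance.maxHeartbeats 200000 in
/-- The complex valued 2-form `B (u, v) - B (v, u)` of a bilinear form `B`. -/
def skewForm : (E →L[ℝ] E →L[ℝ] ℝ) →L[ℝ] E [⋀^Fin 2]→L[ℝ] ℂ :=
  (ContinuousAlternatingMap.alternatizeUncurryFinCLM ℝ E ℂ).comp
    (ContinuousLinearMap.compL ℝ E (E →L[ℝ] ℝ) (E [⋀^Fin 1]→L[ℝ] ℂ)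
      ((ContinuousAlternatingMap.ofSubsingletonLIE (𝕜 := ℝ) (E := E) (F := ℂ)
          (0 : Fin 1)).toContinuousLinearEquiv.toContinuousLinearMap.comp
        (ContinuousLinearMap.compL ℝ E ℝ ℂ Complex.ofRealCLM)))

theorem skewForm_apply (B : E →L[ℝ] E →L[ℝ] ℝ) (v : Fin 2 → E) :
    skewForm E B v = B (v 0) (v 1) - B (v 1) (v 0) := by
  have h : skewForm E B v = ∑ i : Fin 2, (-1) ^ (i : ℕ) • ((B (v i) (i.removeNth v 0) : ℝ) : ℂ) :=
    ContinuousAlternatingMap.alternatizeUncurryFin_apply _ v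
  rw [h, Fin.sum_univ_two]
  simp [Fin.removeNth, sub_eq_add_neg]

variable {M : Type*} [TopologicalSpace M] [ChartedSpace E M] [IsManifold 𝓘(ℝ, E) ∞ M]

namespace QuaternionicHermitianMetric

variable {Q : HypercomplexStructure E M} (h : QuaternionicHermitianMetric Q) (x : M) {y : E}

variable {x} in
theorem omega_inChart_apply (hy : y ∈ (extChartAt 𝓘(ℝ, E) x).target) (L : ImaginaryUnit)
    (v : Fin 2 → E) :
    (h.omega L).inChart x y v = (h.chartMetric x y (v 0) (Q.chartAct x L y (v 1)) : ℝ) := by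
  rw [h.chartMetric_apply hy, Q.frame_chartAct hy]
  rfl

-- Antisymmetrising the bilinear form h(L·,·) = -ω_L gives -2ω_L, whence the factor -1/2. This
-- presents ω_L in the chart as a continuous linear image of a differentiable map.
set_option synthInstance.maxHeartbeats 200000 in
theorem differentiableAt_omega_inChart (L : ImaginaryUnit) :
    DifferentiableAt ℝ ((h.omega L).inChart x) (extChartAt 𝓘(ℝ, E) x x) := by
  have h1 : (h.omega L).inChart x =ᶠ[𝓝 (extChartAt 𝓘(ℝ, E) x x)] fun y => (-1 / 2 : ℝ) •
      skewForm E ((h.chartMetric x y).comp (Q.chartAct x L y)) := by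
    filter_upwards [extChartAt_target_mem_nhds (I := 𝓘(ℝ, E)) x] with y hy
    ext v
    rw [h.omega_inChart_apply hy, ContinuousAlternatingMap.smul_apply, skewForm_apply,
      ContinuousLinearMap.comp_apply, ContinuousLinearMap.comp_apply, h.chartMetric_skew hy,
      h.chartMetric_symm hy (Q.chartAct x L y (v 1)), Complex.real_smul]
    push_cast
    ring
  have h2 := (h.differentiableAt_chartMetric x).clm_comp (Q.differentiableAt_chartAct x L)
  exact (((skewForm E).differentiableAt.comp _ h2).const_smul (-1 / 2 : ℝ)).congr_of_eventuallyEq h1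

theorem deRham_apply {n : ℕ} (η : DiffForm E M n) (v : Fin (n + 1) → E) :
    deRham η x v = ∑ i : Fin (n + 1), (-1) ^ (i : ℕ) •
      fderiv ℝ (η.inChart x) (extChartAt 𝓘(ℝ, E) x x) (v i) (i.removeNth v) := by
  have : IsManifold 𝓘(ℝ, E) 1 M := IsManifold.of_le (n := ∞) (by norm_num)
  have h1 : deRham η x = extDeriv (η.inChart x) (extChartAt 𝓘(ℝ, E) x x) := by
    rw [deRham, mfderiv_extChartAt_self]
    rfl
  rw [h1]
  exact ContinuousAlternatingMap.alternatizeUncurryFin_apply _ v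

theorem fderiv_omega_inChart (L : ImaginaryUnit) (u v w : E) :
    fderiv ℝ ((h.omega L).inChart x) (extChartAt 𝓘(ℝ, E) x x) u ![v, w] =
      (h.derivMetric x u v (Q.centreAct x L w) +
        h.chartMetric x (extChartAt 𝓘(ℝ, E) x x) v (Q.derivAct x L u w) : ℝ) := by
  obtain ⟨h1, h2⟩ := h.hasFDerivAt_chartMetric_apply x (hasFDerivAt_const v _)
    (hasFDerivAt_act_apply (Q := Q) x L w) u
  have h3 := (h.differentiableAt_omega_inChart x L).hasFDerivAt
  have h4 := (ContinuousAlternatingMap.apply ℝ E ℂ ![v, w]).hasFDerivAt.comp _ h3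
  have h5 : (fun y => (h.omega L).inChart x y ![v, w]) =ᶠ[𝓝 (extChartAt 𝓘(ℝ, E) x x)]
      fun y => Complex.ofRealCLM (h.chartMetric x y v (Q.chartAct x L y w)) := by
    filter_upwards [extChartAt_target_mem_nhds (I := 𝓘(ℝ, E)) x] with y hy
    exact h.omega_inChart_apply hy L _
  have h6 := (Complex.ofRealCLM.hasFDerivAt.comp _ h1.hasFDerivAt).congr_of_eventuallyEq h5
  have h7 := congrArg (fun f => f u) (h4.unique h6)
  refine h7.trans (congrArg Complex.ofReal (h2.trans ?_))
  rw [Q.chartAct_self]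
  simp

theorem deRham_omega_apply (L : ImaginaryUnit) {g : E →ₗ[ℝ] E →ₗ[ℝ] E →ₗ[ℝ] ℝ}
    (hg : ∀ u v w,
      (h.derivMetric x u v (Q.centreAct x L w) +
          h.chartMetric x (extChartAt 𝓘(ℝ, E) x x) v (Q.derivAct x L u w)) -
        (h.derivMetric x v u (Q.centreAct x L w) +
          h.chartMetric x (extChartAt 𝓘(ℝ, E) x x) u (Q.derivAct x L v w)) +
        (h.derivMetric x w u (Q.centreAct x L v) +
          h.chartMetric x (extChartAt 𝓘(ℝ, E) x x) u (Q.derivAct x L w v)) =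
      cyclicForm g (Q.centreAct x L : E →ₗ[ℝ] E) u v w) (u v w : E) :
    deRham (h.omega L) x ![u, v, w] = (cyclicForm g (Q.centreAct x L : E →ₗ[ℝ] E) u v w : ℝ) := by
  have e0 : (0 : Fin 3).removeNth ![u, v, w] = ![v, w] := by
    ext i; fin_cases i <;> rfl
  have e1 : (1 : Fin 3).removeNth ![u, v, w] = ![u, w] := by
    ext i; fin_cases i <;> rfl
  have e2 : (2 : Fin 3).removeNth ![u, v, w] = ![u, v] := by
    ext i; fin_cases i <;> rfl
  rw [← hg]
  refine (deRham_apply x (h.omega L) ![u, v, w]).trans ?_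
  rw [Fin.sum_univ_three, e0, e1, e2]
  have f0 := h.fderiv_omega_inChart x L u v w
  have f1 := h.fderiv_omega_inChart x L v u w
  have f2 := h.fderiv_omega_inChart x L w u v
  simp only [Matrix.cons_val_zero, Matrix.cons_val_one, Matrix.cons_val]
  rw [f0, f1, f2]
  push_cast
  simp
  ring

theorem deRham_Omega (t : QuaternionTriple) :
    deRham (h.Omega t) x =
      (1 / 2 : ℂ) • (deRham (h.omega t.J) x + Complex.I • deRham (h.omega t.K) x) := by
  have h1 : (h.Omega t).inChart x =
      (1 / 2 : ℂ) • ((h.omega t.J).inChart x + Complex.I • (h.omega t.K).inChart x) := rfl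
  have h2 := h.differentiableAt_omega_inChart x t.J
  have h3 := h.differentiableAt_omega_inChart x t.K
  have key : ∀ (u : E) (w : Fin 2 → E),
      fderiv ℝ ((h.Omega t).inChart x) (extChartAt 𝓘(ℝ, E) x x) u w =
      1 / 2 * (fderiv ℝ ((h.omega t.J).inChart x) (extChartAt 𝓘(ℝ, E) x x) u w +
        Complex.I * fderiv ℝ ((h.omega t.K).inChart x) (extChartAt 𝓘(ℝ, E) x x) u w) := by
    intro u w
    rw [h1, fderiv_const_smul (h2.add (h3.const_smul _)), fderiv_add h2 (h3.const_smul _),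
      fderiv_const_smul h3]
    rfl
  ext v
  have e : ∀ η : DiffForm E M 2, deRham η x v = _ := fun η => deRham_apply x η v
  rw [ContinuousAlternatingMap.smul_apply, ContinuousAlternatingMap.add_apply,
    ContinuousAlternatingMap.smul_apply, e, e, e, smul_eq_mul, smul_eq_mul, Finset.mul_sum,
    ← Finset.sum_add_distrib, Finset.mul_sum]
  refine Finset.sum_congr rfl fun i _ => ?_
  refine (congrArg _ (key (v i) (i.removeNth v))).trans ?_
  have alg : ∀ (n : ℤ) (a b : ℂ),
      n • (1 / 2 * (a + Complex.I * b)) = 1 / 2 * (n • a + Complex.I * n • b) := by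
    intro n a b
    simp only [zsmul_eq_mul]
    ring
  exact alg _ _ _

/-- The tensor g at x is chosen before the triple, so the conditions for different triples concern
the same g. -/
theorem exists_obstruction (x : M) : ∃ O : QuaternionTriple → Prop, ∀ t,
    (Q.del t.I 2 (h.Omega t) x = 0 ↔ O t) ∧ (Q.dPlus (h.omega t.I) x = 0 ↔ O t) ∧
      (O t → ∀ L, Q.dPlus (h.omega L) x = 0) := by
  obtain ⟨g, hg, hk⟩ := (h.firstOrderData x).exists_tensor
  have hθ : ∀ L u v w, deRham (h.omega L) x ![u, v, w] =
      (cyclicForm g (Q.centreAct x L : E →ₗ[ℝ] E) u v w : ℝ) :=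
    fun L => h.deRham_omega_apply x L (hk L)
  refine ⟨fun t => ∀ a b c, obstruction g (Q.centreAct x t.I : E →ₗ[ℝ] E) (Q.centreAct x t.J)
    (Q.centreAct x t.K) a b c = 0, fun t => ⟨?_, ?_, ?_⟩⟩
  · rw [HypercomplexStructure.del, h.deRham_Omega]
    exact hodgePart_eq_zero_iff_obstruction (A := Q.centreAct x)
      (θ := fun L => deRham (h.omega L) x) t (hg t) hθ
  · exact plusProj_eq_zero_iff_obstruction (A := Q.centreAct x)
      (θ := fun L => deRham (h.omega L) x) t (hg t) hθ
  · exact fun ho => plusProj_eq_zero_of_obstruction (A := Q.centreAct x)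
      (θ := fun L => deRham (h.omega L) x) t (hg t) hθ ho

theorem del_Omega_eq_zero_iff (s t : QuaternionTriple) :
    Q.del s.I 2 (h.Omega s) = 0 ↔ Q.dPlus (h.omega t.I) = 0 := by
  simp only [funext_iff]
  refine forall_congr' fun x => ?_
  obtain ⟨O, hO⟩ := h.exists_obstruction x
  obtain ⟨hs, hs', hs''⟩ := hO s
  obtain ⟨-, ht', ht''⟩ := hO t
  -- The two triples are linked by the vanishing of d₊ω_L for all L: it is used at `t.I` in one
  -- direction and at `s.I` in the other.
  exact ⟨fun H => hs'' (hs.mp H) t.I, fun H => hs.mpr (hs'.mp (ht'' (ht'.mp H) s.I))⟩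

end QuaternionicHermitianMetric

end ExteriorDerivative

end Hypercomplex

end

theorem mainTheorem6 {E : Type*} [NormedAddCommGroup E] [NormedSpace ℝ E] [FiniteDimensional ℝ E]
    {M : Type*} [TopologicalSpace M] [ChartedSpace E M] [IsManifold 𝓘(ℝ, E) ∞ M]
    (Q : Hypercomplex.HypercomplexStructure E M)
    (h : Hypercomplex.QuaternionicHermitianMetric Q)
    (t : Hypercomplex.QuaternionTriple) :
    (Q.del t.I 2 (h.Omega t) = 0 ↔ Q.dPlus (h.omega t.I) = 0) ∧
      (h.IsHKT ↔ Q.dPlus (h.omega t.I) = 0) :=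
  ⟨h.del_Omega_eq_zero_iff t t, h.del_Omega_eq_zero_iff Hypercomplex.stdTriple t⟩
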